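/- Conventions. A circular permutation $[\pi]$ of size $n$ is the set of all rotations of a permutation $\pi=\pi_1\cdots\pi_n$ of $\{1,\dots,n\}$. $[\sigma]$ contains $[\pi]$ if some rotation of $\sigma$ contains $\pi$ as a (linear) pattern, and avoids it otherwise. $[1432,\sigma]$ denotes the set of two patterns $\{[1432],[\sigma]\}$; two sets of patterns are (circular) Wilf equivalent if for every $n\ge 1$ the numbers of circular permutations of size $n$ that avoid all patterns of the one set and of the other set are equal. For a binary word $w=w_1\cdots w_n$ with $w_1=0$, $G(w)$ is the permutation of $\{1,\dots,n\}$ whose one-line notation lists, in increasing order, first the values $v$ with $w_{n+1-v}=1$ and then, in increasing order, the values $v$ with $w_{n+1-v}=0$; $IG(w)$ is the inverse of $G(w)$. For positive integers $n_1,n_2,\dots$, $B(n_1,n_2,n_3,\dots)=0^{n_1}1^{n_2}0^{n_3}\cdots$. A run is a maximal block of equal consecutive letters, a word is alternating if no two consecutive letters are equal, and $\leq_{\mathrm{lex}}$ is the lexicographic order. Theorem. Let $[\sigma]$ be a circular permutation of size $k$ that avoids $[1432]$ and is not the identity circular permutation $[12\cdots k]$. Then $[1432,\sigma]$ is Wilf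 equivalent to $[1432,\tau]$ for some circular permutation $[\tau]$ of size $k$ that has one of the following forms: 1. $[G(w)]$ where $w=0^a1^b0^c$ with $a,b,c\ge 1$ and $a\ge c$; 2. $[G(w)]$ where $w$ is an alternating binary word starting with $0$ and having at least $4$ runs; 3. $[G(w)]$ where $w=B(n_1,n_2,\dots,n_\ell,1^r)$ (that is, $(n_1,\dots,n_\ell)$ followed by $r$ parts equal to $1$) has at least $4$ runs, $\ell\ge1$, $r\ge 0$, all $n_i\ge 1$, $n_1\ne1$, $n_\ell\neq 1$, and $(n_\ell,\dots,n_2,n_1)\leq_{\mathrm{lex}}(n_1,n_2,\dots,n_\ell)$; 4. $[IG(w)]$ where $w=0^{n_1}1^{n_2}\cdots1^{n_\ell}0^m$ ($\ell$ even, all $n_i\ge1$, $m\ge1$) is not alternating, has at least $5$ runs, and $(n_\ell,\dots,n_2,n_1)\leq_{\mathrm{lex}}(n_1,n_2,\dots,n_\ell)$. -/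

import Mathlib

namespace CircularPatterns

/-- Circular permutations of size `n`: permutations of `Fin n` (in one-line notation
`σ 0, σ 1, …, σ (n - 1)`, with values shifted down by one) up to rotation. The one-line notation
of `σ * finRotate n ^ j` is that of `σ` rotated by `j` places. -/
abbrev CircPerm (n : ℕ) : Type := Equiv.Perm (Fin n) ⧸ Subgroup.zpowers (finRotate n)

/-- The circular permutation `[σ]`. -/
abbrev circ {n : ℕ} (σ : Equiv.Perm (Fin n)) : CircPerm n := QuotientGroup.mk σ

/-- The linear permutation `σ` contains the linear pattern `π`. -/
def LinContains {n m : ℕ} (σ : Equiv.Perm (Fin n)) (π : Equiv.Perm (Fin m)) : Prop :=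
  ∃ h : Fin m → Fin n, StrictMono h ∧ ∀ i j, σ (h i) < σ (h j) ↔ π i < π j

/-- The circular permutation `C` contains the circular pattern `P`. By `contains_circ_iff` below,
`[σ]` contains `[π]` iff some rotation of `σ` contains `π` linearly. -/
def Contains {n m : ℕ} (C : CircPerm n) (P : CircPerm m) : Prop :=
  ∃ (σ : Equiv.Perm (Fin n)) (π : Equiv.Perm (Fin m)),
    circ σ = C ∧ circ π = P ∧ LinContains σ π

theorem coe_finRotate_pow (n j : ℕ) (i : Fin (n + 1)) :
    (((finRotate (n + 1)) ^ j) i : ℕ) = (i + j) % (n + 1) := by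
  induction j with
  | zero => simp [Nat.mod_eq_of_lt i.isLt]
  | succ j ih =>
    rw [pow_succ', Equiv.Perm.mul_apply, finRotate_apply, Fin.val_add, ih, Fin.val_one',
      ← Nat.add_mod, add_assoc]

theorem linContains_rotate {n m : ℕ} {σ : Equiv.Perm (Fin n)} {π : Equiv.Perm (Fin m)}
    (hc : LinContains σ π) : ∃ j : ℕ, LinContains (σ * finRotate n ^ j) (π * finRotate m) := by
  obtain ⟨h, hm, hl⟩ := hc
  cases m with
  | zero => exact ⟨0, Fin.elim0, fun i => i.elim0, fun i => i.elim0⟩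
  | succ m =>
    cases n with
    | zero => exact (h 0).elim0
    | succ n =>
      have key : ∀ i : Fin (m + 1), ∃ k : Fin (n + 1),
          (finRotate (n + 1) ^ ((h 0 : ℕ) + 1)) k = h (finRotate (m + 1) i) ∧
          ((k : ℕ) + h 0 + 1 = h (finRotate (m + 1) i) ∧ i ≠ Fin.last m ∨
            (k : ℕ) = n ∧ i = Fin.last m) := by
        intro i
        by_cases hi : i = Fin.last m
        · refine ⟨Fin.last n, ?_, Or.inr ⟨rfl, hi⟩⟩
          apply Fin.ext
          rw [coe_finRotate_pow, hi, finRotate_last]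
          have := (h 0).isLt
          have e : (Fin.last n : ℕ) + ((h 0 : ℕ) + 1) = (h 0 : ℕ) + (n + 1) := by
            simp; omega
          rw [e, Nat.add_mod_right, Nat.mod_eq_of_lt this]
        · have hlt : h 0 < h (finRotate (m + 1) i) := by
            apply hm
            rw [Fin.lt_def, coe_finRotate_of_ne_last hi]
            simp
          have hb := (h (finRotate (m + 1) i)).isLt
          rw [Fin.lt_def] at hlt
          refine ⟨⟨h (finRotate (m + 1) i) - (h 0 + 1), by omega⟩, ?_, Or.inl ⟨?_, hi⟩⟩
          · apply Fin.ext
            rw [coe_finRotate_pow]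
            simp only
            rw [Nat.sub_add_cancel hlt, Nat.mod_eq_of_lt hb]
          · simp only
            omega
      choose k hk hk' using key
      refine ⟨(h 0 : ℕ) + 1, k, ?_, ?_⟩
      · intro a b hab
        have ha : a ≠ Fin.last m := (lt_of_lt_of_le hab (Fin.le_last b)).ne
        have hka := (hk' a).resolve_right (fun hh => ha hh.2)
        have hba := (h (finRotate (m + 1) a)).isLt
        rw [Fin.lt_def]
        rcases hk' b with ⟨hb, hb'⟩ | ⟨hb, hb'⟩
        · have : h (finRotate (m + 1) a) < h (finRotate (m + 1) b) := by
            apply hm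
            rw [Fin.lt_def, coe_finRotate_of_ne_last ha, coe_finRotate_of_ne_last hb']
            rw [Fin.lt_def] at hab
            omega
          rw [Fin.lt_def] at this
          omega
        · omega
      · intro a b
        rw [Equiv.Perm.mul_apply, Equiv.Perm.mul_apply, Equiv.Perm.mul_apply,
          Equiv.Perm.mul_apply, hk, hk]
        exact hl _ _

theorem linContains_rotate_pow {n m : ℕ} {σ : Equiv.Perm (Fin n)} {π : Equiv.Perm (Fin m)}
    (hc : LinContains σ π) (i : ℕ) :
    ∃ j : ℕ, LinContains (σ * finRotate n ^ j) (π * finRotate m ^ i) := by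
  induction i with
  | zero => exact ⟨0, by simpa using hc⟩
  | succ i ih =>
    obtain ⟨j, hj⟩ := ih
    obtain ⟨l, hl⟩ := linContains_rotate hj
    exact ⟨j + l, by rw [pow_add, ← mul_assoc, pow_succ, ← mul_assoc]; exact hl⟩

theorem circ_eq_circ_iff {n : ℕ} {σ τ : Equiv.Perm (Fin n)} :
    circ σ = circ τ ↔ ∃ j : ℕ, τ = σ * finRotate n ^ j := by
  rw [QuotientGroup.eq, ← mem_powers_iff_mem_zpowers, Submonoid.mem_powers_iff]
  constructor
  · rintro ⟨j, hj⟩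
    exact ⟨j, by rw [hj]; group⟩
  · rintro ⟨j, hj⟩
    exact ⟨j, by rw [hj]; group⟩

/-- Containment in terms of fixed representatives. -/
theorem contains_circ_iff {n m : ℕ} (σ : Equiv.Perm (Fin n)) (π : Equiv.Perm (Fin m)) :
    Contains (circ σ) (circ π) ↔ ∃ j : ℕ, LinContains (σ * finRotate n ^ j) π := by
  constructor
  · rintro ⟨σ', π', hσ, hπ, hc⟩
    obtain ⟨a, rfl⟩ := circ_eq_circ_iff.1 hσ.symm
    obtain ⟨b, rfl⟩ := circ_eq_circ_iff.1 hπ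
    obtain ⟨j, hj⟩ := linContains_rotate_pow hc b
    exact ⟨a + j, by rw [pow_add, ← mul_assoc]; exact hj⟩
  · rintro ⟨j, hj⟩
    exact ⟨_, π, (circ_eq_circ_iff.2 ⟨j, rfl⟩).symm, rfl, hj⟩

/-- A circular pattern of arbitrary size. -/
abbrev Pattern : Type := (m : ℕ) × CircPerm m

/-- `Av n S`: the circular permutations of size `n` that avoid every pattern in `S`. -/
def Av (n : ℕ) (S : Set Pattern) : Set (CircPerm n) :=
  {C | ∀ P ∈ S, ¬ Contains C P.2}

/-- Circular Wilf equivalence of two sets of patterns. -/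
def WilfEquiv (S T : Set Pattern) : Prop :=
  ∀ n : ℕ, 1 ≤ n → (Av n S).ncard = (Av n T).ncard

/-- The permutation `1432`. -/
def perm1432 : Equiv.Perm (Fin 4) :=
  ⟨![0, 3, 2, 1], ![0, 3, 2, 1], by decide, by decide⟩

/-- The pair of patterns `[1432, σ]`. -/
def pair1432 {k : ℕ} (P : CircPerm k) : Set Pattern :=
  {⟨4, circ perm1432⟩, ⟨k, P⟩}

/-! Binary words are lists of Booleans, with `false` for the letter `0` and `true` for `1`. -/

/-- `G w`, for a word `w` starting with `0`. The `i`-th letter of `w` belongs to the `i`-th largest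
value; the one-line notation of `G w` lists the values with letter `1` in increasing order and then
the values with letter `0` in increasing order (`Tuple.sort` is the stable sort, and
`!true < !false`). If `w` has at most two runs, this is the identity. -/
def G (w : List Bool) : Equiv.Perm (Fin w.length) :=
  Tuple.sort fun v : Fin w.length => !(w.get v.rev)

/-- `IG w` is the inverse of `G w`. -/
def IG (w : List Bool) : Equiv.Perm (Fin w.length) := (G w)⁻¹

/-- The word with run sizes `n₁, n₂, …` whose first letter is `b`. -/
def wordFrom (b : Bool) : List ℕ → List Bool
  | [] => []
  | n :: l => List.replicate n b ++ wordFrom (!b) l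

/-- `B (n₁, n₂, n₃, …) = 0^n₁ 1^n₂ 0^n₃ ⋯`. -/
def B (l : List ℕ) : List Bool := wordFrom false l

/-- The number of runs (maximal blocks of equal consecutive letters). -/
def numRuns (w : List Bool) : ℕ := (w.splitBy (· == ·)).length

/-- No two consecutive letters are equal. -/
def Alternating (w : List Bool) : Prop := w.IsChain (· ≠ ·)

/-- `w = 0^a 1^b 0^c` with `a ≥ c` (three runs). -/
def Form1 (w : List Bool) : Prop :=
  ∃ a b c : ℕ, 1 ≤ a ∧ 1 ≤ b ∧ 1 ≤ c ∧ c ≤ a ∧ w = B [a, b, c]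

/-- `w` is alternating, starts with `0` and has at least `4` runs. -/
def Form2 (w : List Bool) : Prop :=
  w.head? = some false ∧ Alternating w ∧ 4 ≤ numRuns w

/-- `w = B (n₁, …, n_k, 1^r)` has at least `4` runs, `k ≥ 1`, `r ≥ 0`, `n₁ ≠ 1`, `n_k ≠ 1` and
`(n_k, …, n₁) ≤ (n₁, …, n_k)` lexicographically. -/
def Form3 (w : List Bool) : Prop :=
  ∃ (l : List ℕ) (hl : l ≠ []) (r : ℕ), (∀ x ∈ l, 1 ≤ x) ∧ w = B (l ++ List.replicate r 1) ∧
    4 ≤ numRuns w ∧ l.head hl ≠ 1 ∧ l.getLast hl ≠ 1 ∧ l.reverse ≤ l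

/-- `w = 0^n₁ 1^n₂ ⋯ 1^n_k 0^m` (so `k` is even) is not alternating, has at least `5` runs, `m ≥ 1`
and `(n_k, …, n₁) ≤ (n₁, …, n_k)` lexicographically. -/
def Form4 (w : List Bool) : Prop :=
  ∃ (l : List ℕ) (m : ℕ), (∀ x ∈ l, 1 ≤ x) ∧ Even l.length ∧ 1 ≤ m ∧ w = B (l ++ [m]) ∧
    ¬ Alternating w ∧ 5 ≤ numRuns w ∧ l.reverse ≤ l

/-- `P` is `[G(w)]` with `w` of one of the first three forms, or `[IG(w)]` with `w` of the
fourth form. -/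
def IsListed (P : Pattern) : Prop :=
  (∃ w : List Bool, (Form1 w ∨ Form2 w ∨ Form3 w) ∧ P = ⟨w.length, circ (G w)⟩) ∨
  (∃ w : List Bool, Form4 w ∧ P = ⟨w.length, circ (IG w)⟩)

end CircularPatterns

namespace CircularPatterns

/-! Rotate a circular permutation avoiding [1432] so that its maximum comes last. It then avoids
321, since 321 followed by the maximum is 3214, a rotation of 1432, and it avoids 2143, another
rotation. This forces it to be some G(u), whose only possible descent lies between two increasing
blocks, or the inverse of one (`exists_word_of_not_contains_perm1432`).

The patterns in G(u) and IG(u) are the G(v) and IG(v) with v a subword of u, so containment becomes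
a question about binary words once the coincidences are known. For words with enough runs, [G]
identifies a word only with its complement, and [IG] identifies 1x with x0, so that the class of
N0^m, where N begins with 0 and ends with 1, consists of the words 1^i N 0^j with i + j = m. For
words starting with 0, the two families overlap exactly when there are at most four runs: there G(u)
exchanges two adjacent blocks, and its inverse is of the same kind. The subword 01010 detects a
fifth run.

Wilf equivalence now compares numbers of words containing a pattern word. For G(w), the main term
`count` is invariant under reversal, and a recursion in n shows that prepending a run of size 1
preserves equality of counts. Hence outer runs of size 1 can all be moved to the end and the
remaining runs reversed (`count_B_ones`). A pattern with four runs also lies in some IG(u) with u of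
at least five runs, but that contribution depends only on the size. For IG(w) with at least five
runs, an even number of runs leaves plain subword containment, whose count depends only on the
length of w, so w may be replaced by an alternating word. For an odd number, reverse complement
together with an exchange of first and last letters reverses all runs but the last. -/

/-! ### Rotating the pattern instead of the permutation -/

theorem linContains_mul_finRotate {n m : ℕ} {σ : Equiv.Perm (Fin n)} {π : Equiv.Perm (Fin m)}
    (hc : LinContains σ π) : ∃ i : ℕ, LinContains (σ * finRotate n) (π * finRotate m ^ i) := by
  obtain ⟨h, hm, hl⟩ := hc
  rcases m with _ | m
  · exact ⟨0, Fin.elim0, fun i => i.elim0, fun i => i.elim0⟩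
  rcases n with _ | n
  · exact (h 0).elim0
  by_cases h0 : h 0 = 0
  -- The occurrence uses the entry that rotation carries from the front to the end, so the pattern
  -- is rotated along with it.
  · refine ⟨1, fun i => (finRotate (n + 1)).symm (h (finRotate (m + 1) i)), ?_, ?_⟩
    · have key : ∀ i : Fin (m + 1),
          (((finRotate (n + 1)).symm (h (finRotate (m + 1) i)) : ℕ) + 1 =
            h (finRotate (m + 1) i) ∧ i ≠ Fin.last m) ∨
          (((finRotate (n + 1)).symm (h (finRotate (m + 1) i)) : ℕ) = n ∧ i = Fin.last m) := by
        intro i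
        set x := (finRotate (n + 1)).symm (h (finRotate (m + 1) i)) with hx
        have hx' : finRotate (n + 1) x = h (finRotate (m + 1) i) := by simp [hx]
        rw [← hx']
        by_cases hi : i = Fin.last m
        · right
          refine ⟨?_, hi⟩
          rw [hi, finRotate_last, h0] at hx'
          have := congrArg Fin.val hx'
          rw [coe_finRotate] at this
          split_ifs at this with hh
          · simp [hh]
          · simp at this
        · left
          refine ⟨?_, hi⟩
          rw [coe_finRotate]
          split_ifs with hh
          · exfalso
            rw [hh, finRotate_last] at hx'
            have : h 0 < h (finRotate (m + 1) i) := by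
              apply hm
              rw [Fin.lt_def, coe_finRotate_of_ne_last hi]
              simp
            rw [← hx'] at this
            simp at this
          · rfl
      intro a b hab
      have ha : a ≠ Fin.last m := (lt_of_lt_of_le hab (Fin.le_last b)).ne
      rw [Fin.lt_def]
      have hka := (key a).resolve_right (fun hh => ha hh.2)
      rcases key b with ⟨hb, hb'⟩ | ⟨hb, hb'⟩
      · have : h (finRotate (m + 1) a) < h (finRotate (m + 1) b) := by
          apply hm
          rw [Fin.lt_def, coe_finRotate_of_ne_last ha, coe_finRotate_of_ne_last hb']
          rw [Fin.lt_def] at hab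
          omega
        rw [Fin.lt_def] at this
        dsimp only
        omega
      · have := (h (finRotate (m + 1) a)).isLt
        dsimp only
        omega
    · intro i j
      simpa using hl _ _
  -- The front entry is unused: every position of the occurrence drops by one and the pattern stays
  -- the same.
  · refine ⟨0, fun i => (finRotate (n + 1)).symm (h i), ?_, ?_⟩
    · have key : ∀ i : Fin (m + 1), (((finRotate (n + 1)).symm (h i) : ℕ) + 1 = h i) := by
        intro i
        set x := (finRotate (n + 1)).symm (h i) with hx
        have hx' : finRotate (n + 1) x = h i := by simp [hx]
        rw [← hx', coe_finRotate]
        split_ifs with hh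
        · exfalso
          rw [hh, finRotate_last] at hx'
          have : h 0 ≤ h i := hm.monotone (Fin.zero_le i)
          rw [← hx'] at this
          exact h0 (le_antisymm this (Fin.zero_le _))
        · rfl
      intro a b hab
      have := hm hab
      rw [Fin.lt_def] at *
      have := key a
      have := key b
      dsimp only
      omega
    · intro i j
      simpa using hl _ _

theorem linContains_mul_finRotate_pow {n m : ℕ} {σ : Equiv.Perm (Fin n)} {π : Equiv.Perm (Fin m)}
    (hc : LinContains σ π) (j : ℕ) :
    ∃ i : ℕ, LinContains (σ * finRotate n ^ j) (π * finRotate m ^ i) := by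
  induction j with
  | zero => exact ⟨0, by simpa using hc⟩
  | succ j ih =>
    obtain ⟨i, hi⟩ := ih
    obtain ⟨l, hl⟩ := linContains_mul_finRotate hi
    exact ⟨i + l, by rw [pow_add (finRotate m), ← mul_assoc, pow_succ, ← mul_assoc]; exact hl⟩

/-- For a fixed representative of the circular permutation it suffices to rotate the pattern. -/
theorem contains_circ_iff_exists_pattern {n m : ℕ} (σ : Equiv.Perm (Fin n)) (P : CircPerm m) :
    Contains (circ σ) P ↔ ∃ π : Equiv.Perm (Fin m), circ π = P ∧ LinContains σ π := by
  constructor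
  · rintro ⟨σ', π', hσ, hπ, hc⟩
    obtain ⟨a, rfl⟩ := circ_eq_circ_iff.1 hσ
    obtain ⟨i, hi⟩ := linContains_mul_finRotate_pow hc a
    exact ⟨_, by rw [← hπ]; exact (circ_eq_circ_iff.2 ⟨i, rfl⟩).symm, hi⟩
  · rintro ⟨π, hπ, hc⟩
    exact ⟨σ, π, rfl, hπ, hc⟩

theorem LinContains.inv {n m : ℕ} {σ : Equiv.Perm (Fin n)} {π : Equiv.Perm (Fin m)}
    (hc : LinContains σ π) : LinContains σ⁻¹ π⁻¹ := by
  obtain ⟨h, hm, hl⟩ := hc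
  refine ⟨fun i => σ (h (π⁻¹ i)), fun i j hij => ?_, fun i j => ?_⟩
  · rw [hl]; simpa using hij
  · simp [hm.lt_iff_lt]

theorem linContains_inv_iff {n m : ℕ} {σ : Equiv.Perm (Fin n)} {π : Equiv.Perm (Fin m)} :
    LinContains σ⁻¹ π ↔ LinContains σ π⁻¹ :=
  ⟨fun h => by simpa using h.inv, fun h => by simpa using h.inv⟩

/-! ### Permutations sorted by a two-valued labelling, and subwords -/

/-- The permutation listing first the values labelled `true`, then those labelled `false`, both in
increasing order. -/
def grass {n : ℕ} (f : Fin n → Bool) : Equiv.Perm (Fin n) := Tuple.sort fun v => !(f v)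

theorem eq_grass_iff {n : ℕ} {f : Fin n → Bool} {σ : Equiv.Perm (Fin n)} :
    σ = grass f ↔ ∀ i j, i < j →
      (f (σ i) = f (σ j) ∧ σ i < σ j) ∨ (f (σ i) = true ∧ f (σ j) = false) := by
  rw [grass, Tuple.eq_sort_iff]
  constructor
  · rintro ⟨h1, h2⟩ i j hij
    have := h1 hij.le
    have := h2 i j hij
    simp only [Function.comp] at *
    cases h : f (σ i) <;> cases h' : f (σ j) <;> simp_all [not_le_of_gt]
  · intro h
    refine ⟨fun i j hij => ?_, fun i j hij => ?_⟩
    · rcases hij.eq_or_lt with rfl | hij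
      · rfl
      · have := h i j hij
        simp only [Function.comp]
        cases h : f (σ i) <;> cases h' : f (σ j) <;> simp_all
    · have := h i j hij
      cases h : f (σ i) <;> cases h' : f (σ j) <;> simp_all

theorem grass_spec {n : ℕ} (f : Fin n → Bool) {i j : Fin n} (hij : i < j) :
    (f (grass f i) = f (grass f j) ∧ grass f i < grass f j) ∨
      (f (grass f i) = true ∧ f (grass f j) = false) :=
  eq_grass_iff.1 rfl i j hij

theorem grass_lt_iff {n : ℕ} (f : Fin n → Bool) {i j : Fin n} :
    i < j ↔ (f (grass f i) = f (grass f j) ∧ grass f i < grass f j) ∨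
      (f (grass f i) = true ∧ f (grass f j) = false) := by
  refine ⟨grass_spec f, fun h => ?_⟩
  by_contra hc
  rcases (not_lt.1 hc).eq_or_lt with e | h'
  · subst e; simp at h
  · have := grass_spec f h'
    rcases h with ⟨h1, h2⟩ | ⟨h1, h2⟩ <;> rcases this with ⟨h3, h4⟩ | ⟨h3, h4⟩
    · exact lt_asymm h2 h4
    · simp_all
    · simp_all
    · simp_all

/-- An occurrence is determined by its set of values, and sorting by label commutes with restricting
to a set of values. The map `e` enumerates these values in increasing order. -/
theorem linContains_grass_iff {n m : ℕ} {f : Fin n → Bool} {π : Equiv.Perm (Fin m)} :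
    LinContains (grass f) π ↔ ∃ e : Fin m → Fin n, StrictMono e ∧ π = grass (f ∘ e) := by
  constructor
  · rintro ⟨h, hm, hl⟩
    refine ⟨fun v => grass f (h (π⁻¹ v)), fun i j hij => ?_, ?_⟩
    · rw [hl]; simpa using hij
    · rw [eq_grass_iff]
      intro i j hij
      have := grass_spec f (hm hij)
      simpa [← hl i j] using this
  · rintro ⟨e, he, rfl⟩
    refine ⟨fun i => (grass f)⁻¹ (e (grass (f ∘ e) i)), fun i j hij => ?_, fun i j => ?_⟩
    · rw [grass_lt_iff f]
      have := grass_spec (f ∘ e) hij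
      simpa [he.lt_iff_lt] using this
    · simp [he.lt_iff_lt]

/-- The label of the values given by a word: the first letter belongs to the largest value. -/
def label (n : ℕ) (u : List Bool) (v : Fin n) : Bool := u.getD v.rev false

/-- `G u` for a word `u` of length `n`. -/
def gw (n : ℕ) (u : List Bool) : Equiv.Perm (Fin n) := grass (label n u)

theorem gw_length (u : List Bool) : gw u.length u = G u := by
  unfold gw grass G
  congr 1
  funext v
  rw [label, List.getD_eq_getElem _ _ v.rev.isLt]
  rfl

/-- Selecting values amounts to selecting letters. Words run from the largest value down, so the
embeddings of values and of letters are conjugate under `Fin.rev`. -/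
theorem exists_sublist_iff {n m : ℕ} {u : List Bool} (hu : u.length = n) (F : (Fin m → Bool) → Prop) :
    (∃ e : Fin m → Fin n, StrictMono e ∧ F (label n u ∘ e)) ↔
      ∃ v : List Bool, v.length = m ∧ v.Sublist u ∧ F (label m v) := by
  subst hu
  constructor
  · rintro ⟨e, he, hF⟩
    refine ⟨List.ofFn fun i : Fin m => u.get (e i.rev).rev, by simp, ?_, ?_⟩
    · rw [List.sublist_iff_exists_fin_orderEmbedding_get_eq]
      refine ⟨OrderEmbedding.ofStrictMono (fun i => (e (Fin.cast (by simp) i).rev).rev) ?_, ?_⟩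
      · intro i j hij
        simp only [Fin.rev_lt_rev]
        apply he
        simpa using hij
      · intro i
        simp only [List.get_eq_getElem, List.getElem_ofFn]
        rfl
    · convert hF using 1
      funext v
      simp only [label, Function.comp]
      rw [List.getD_eq_getElem _ _ (e v).rev.isLt,
        List.getD_eq_getElem _ _ (by simpa only [List.length_ofFn] using v.rev.isLt),
        List.getElem_ofFn]
      simp only [Fin.eta, Fin.rev_rev, List.get_eq_getElem]
  · rintro ⟨v, rfl, hv, hF⟩
    rw [List.sublist_iff_exists_fin_orderEmbedding_get_eq] at hv
    obtain ⟨e, he⟩ := hv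
    refine ⟨fun i => (e i.rev).rev, fun i j hij => ?_, ?_⟩
    · simpa using hij
    · convert hF using 1
      funext i
      have := he i.rev
      simp only [List.get_eq_getElem] at this
      simp only [label, Function.comp, Fin.rev_rev]
      rw [List.getD_eq_getElem _ _ (e i.rev).isLt, List.getD_eq_getElem _ _ i.rev.isLt]
      exact this.symm

theorem contains_circ_gw_iff {n m : ℕ} {u : List Bool} (hu : u.length = n) (P : CircPerm m) :
    Contains (circ (gw n u)) P ↔
      ∃ v : List Bool, v.length = m ∧ v.Sublist u ∧ circ (gw m v) = P := by
  rw [contains_circ_iff_exists_pattern]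
  simp only [gw, linContains_grass_iff]
  rw [← exists_sublist_iff hu (fun f => circ (grass f) = P)]
  constructor
  · rintro ⟨π, h, e, he, rfl⟩
    exact ⟨e, he, h⟩
  · rintro ⟨e, he, h⟩
    exact ⟨_, h, e, he, rfl⟩

theorem contains_circ_gw_inv_iff {n m : ℕ} {u : List Bool} (hu : u.length = n) (P : CircPerm m) :
    Contains (circ (gw n u)⁻¹) P ↔
      ∃ v : List Bool, v.length = m ∧ v.Sublist u ∧ circ (gw m v)⁻¹ = P := by
  rw [contains_circ_iff_exists_pattern]
  simp only [linContains_inv_iff, gw, linContains_grass_iff]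
  rw [← exists_sublist_iff hu (fun f => circ (grass f)⁻¹ = P)]
  constructor
  · rintro ⟨π, h, e, he, h'⟩
    refine ⟨e, he, ?_⟩
    rw [← h', inv_inv, h]
  · rintro ⟨e, he, h⟩
    exact ⟨_, h, e, he, inv_inv _⟩

/-! ### When two words give the same circular permutation -/

theorem exists_grass_true_iff_lt {n : ℕ} (f : Fin n → Bool) :
    ∃ a ≤ n, ∀ i : Fin n, f (grass f i) = true ↔ (i : ℕ) < a := by
  classical
  by_cases h : ∃ a : ℕ, ∃ ha : a < n, f (grass f ⟨a, ha⟩) = false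
  · obtain ⟨ha, hf⟩ := Nat.find_spec h
    refine ⟨Nat.find h, ha.le, fun i => ⟨fun hi => ?_, fun hi => ?_⟩⟩
    · by_contra hc
      rcases (not_lt.1 hc).eq_or_lt with e | h'
      · have : (⟨Nat.find h, ha⟩ : Fin n) = i := Fin.ext e
        rw [this, hi] at hf
        simp at hf
      · have := grass_spec f (show (⟨Nat.find h, ha⟩ : Fin n) < i from h')
        simp_all
    · have := Nat.find_min h hi
      by_contra hc
      exact this ⟨i.isLt, by simpa using hc⟩
  · refine ⟨n, le_rfl, fun i => ⟨fun _ => i.isLt, fun _ => ?_⟩⟩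
    by_contra hc
    exact h ⟨i, i.isLt, by simpa using hc⟩

/-- Complementing the labels exchanges the two increasing blocks, which is the rotation by the
length `a` of the first block. -/
theorem circ_grass_not {n : ℕ} (f : Fin n → Bool) :
    circ (grass fun v => !(f v)) = circ (grass f) := by
  rcases n with _ | n
  · exact congrArg circ (Subsingleton.elim _ _)
  obtain ⟨a, ha, hf⟩ := exists_grass_true_iff_lt f
  symm
  rw [circ_eq_circ_iff]
  refine ⟨a, (eq_grass_iff.2 fun i j hij => ?_).symm⟩
  simp only [Equiv.Perm.mul_apply]
  set p := (finRotate (n + 1) ^ a) i with hp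
  set q := (finRotate (n + 1) ^ a) j with hq
  have hp' := coe_finRotate_pow n a i
  have hq' := coe_finRotate_pow n a j
  rw [← hp] at hp'
  rw [← hq] at hq'
  rw [Fin.lt_def] at hij
  have hi := i.isLt
  have hj := j.isLt
  have e : ∀ x, x < n + 1 → (x + a) % (n + 1) = if x + a < n + 1 then x + a else x + a - (n + 1) := by
    intro x hx
    split_ifs with h
    · exact Nat.mod_eq_of_lt h
    · rw [Nat.mod_eq_sub_mod (by omega), Nat.mod_eq_of_lt (by omega)]
  rw [e _ hi] at hp'
  rw [e _ hj] at hq'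
  have fp := hf p
  have fq := hf q
  have := @grass_spec _ f p q
  rw [Fin.lt_def (a := p)] at this
  clear_value p q
  clear hp hq e hf
  split_ifs at hp' hq' with h1 h2
  · have h3 : ¬ (p : ℕ) < a := by omega
    have h4 : ¬ (q : ℕ) < a := by omega
    have h5 := this (by omega)
    simp_all
  · have h3 : ¬ (p : ℕ) < a := by omega
    have h4 : (q : ℕ) < a := by omega
    simp_all
  · omega
  · have h3 : (p : ℕ) < a := by omega
    have h4 : (q : ℕ) < a := by omega
    have h5 := this (by omega)
    simp_all

theorem label_map_not {n : ℕ} {u : List Bool} (hu : u.length = n) :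
    label n (u.map (!·)) = fun v => !(label n u v) := by
  subst hu
  funext v
  simp only [label]
  rw [List.getD_eq_getElem _ _ v.rev.isLt, List.getD_eq_getElem _ _ (by rw [List.length_map]; exact v.rev.isLt),
    List.getElem_map]

theorem circ_gw_map_not {n : ℕ} {u : List Bool} (hu : u.length = n) :
    circ (gw n (u.map (!·))) = circ (gw n u) := by
  rw [gw, label_map_not hu, circ_grass_not, gw]

theorem label_injective {n : ℕ} {u v : List Bool} (hu : u.length = n) (hv : v.length = n)
    (h : label n u = label n v) : u = v := by
  subst hu
  refine List.ext_getElem hv.symm fun i h1 h2 => ?_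
  have := congrFun h (⟨i, h1⟩ : Fin u.length).rev
  simp only [label, Fin.rev_rev] at this
  rwa [List.getD_eq_getElem _ _ h1, List.getD_eq_getElem _ _ h2] at this

/-- Adding 1 cyclically to all values turns the maximum, the last entry of the `true` block, into
the minimum. With its label changed to `false` it is the first entry of the other block, hence stays
where it was. For the inverses this shift of values becomes a rotation of positions. -/
theorem finRotate_mul_gw {n : ℕ} {x : List Bool} (hx : x.length = n) :
    finRotate (n + 1) * gw (n + 1) (true :: x) = gw (n + 1) (x ++ [false]) := by
  have hlast : label (n + 1) (true :: x) (Fin.last n) = true := by simp [label]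
  have hzero : label (n + 1) (x ++ [false]) 0 = false := by simp [label, ← hx]
  have hne : ∀ v : Fin (n + 1), v ≠ Fin.last n →
      label (n + 1) (x ++ [false]) (finRotate (n + 1) v) = label (n + 1) (true :: x) v := by
    intro v hv
    have h1 := coe_finRotate_of_ne_last hv
    have h2 : (v : ℕ) < n := Fin.val_lt_last hv
    simp only [label, Fin.val_rev, h1]
    obtain ⟨d, hd⟩ : ∃ d, n = v + 1 + d := ⟨n - (v + 1), by omega⟩
    have e1 : n + 1 - ((v : ℕ) + 1 + 1) = d := by omega
    have e2 : n + 1 - ((v : ℕ) + 1) = d + 1 := by omega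
    rw [e1, e2, List.getD_cons_succ, List.getD_append _ _ _ _ (by omega)]
  rw [gw, gw, eq_grass_iff]
  intro i j hij
  simp only [Equiv.Perm.mul_apply]
  have hs := grass_spec (label (n + 1) (true :: x)) hij
  set p := grass (label (n + 1) (true :: x)) i with hp
  set q := grass (label (n + 1) (true :: x)) j with hq
  have hpq : p ≠ q := by simp [hp, hq, hij.ne]
  by_cases hpl : p = Fin.last n
  · have hql : q ≠ Fin.last n := fun h => hpq (hpl.trans h.symm)
    have h1 := coe_finRotate_of_ne_last hql
    rw [hne q hql]
    rw [hpl, finRotate_last, hzero]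
    rw [hpl, hlast] at hs
    rcases hs with ⟨_, h⟩ | ⟨_, h⟩
    · exact absurd h (not_lt.2 (Fin.le_last q))
    · left
      refine ⟨h.symm, ?_⟩
      rw [Fin.lt_def, h1]
      simp
  · rw [hne p hpl]
    by_cases hql : q = Fin.last n
    · right
      rw [hql, finRotate_last, hzero]
      rw [hql, hlast] at hs
      rcases hs with ⟨h, _⟩ | ⟨h, _⟩ <;> exact ⟨h, rfl⟩
    · rw [hne q hql, Fin.lt_def, coe_finRotate_of_ne_last hpl, coe_finRotate_of_ne_last hql]
      rw [Fin.lt_def] at hs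
      simpa using hs

theorem circ_gw_inv_shift {n : ℕ} {x : List Bool} (hx : x.length = n) :
    circ (gw (n + 1) (true :: x))⁻¹ = circ (gw (n + 1) (x ++ [false]))⁻¹ := by
  symm
  rw [circ_eq_circ_iff, ← finRotate_mul_gw hx]
  exact ⟨1, by group⟩

theorem circ_gw_inv_shift_replicate {n i : ℕ} {x : List Bool} (hx : i + x.length = n) :
    circ (gw n (List.replicate i true ++ x))⁻¹ = circ (gw n (x ++ List.replicate i false))⁻¹ := by
  induction i generalizing x with
  | zero => simp
  | succ i ih =>
    obtain ⟨n, rfl⟩ : ∃ n', n = n' + 1 := ⟨n - 1, by omega⟩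
    rw [List.replicate_succ, List.cons_append, circ_gw_inv_shift (by simp; omega), List.append_assoc,
      ih (by simp; omega)]
    simp [List.replicate_succ]

theorem gw_last {n : ℕ} (x : List Bool) : gw (n + 1) (false :: x) (Fin.last n) = Fin.last n := by
  set f := label (n + 1) (false :: x) with hf
  have hl : f (Fin.last n) = false := by simp [hf, label]
  change grass f (Fin.last n) = Fin.last n
  by_contra hc
  have h1 : (grass f)⁻¹ (Fin.last n) < Fin.last n := by
    refine lt_of_le_of_ne (Fin.le_last _) fun h => hc ?_
    rw [Equiv.Perm.inv_eq_iff_eq] at h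
    exact h.symm
  have := grass_spec f h1
  rw [← Equiv.Perm.mul_apply, mul_inv_cancel, Equiv.Perm.one_apply] at this
  rcases this with ⟨_, h⟩ | ⟨h, _⟩
  · exact absurd h (not_lt.2 (Fin.le_last _))
  · simp [hl] at h

theorem gw_inv_last {n : ℕ} (x : List Bool) :
    (gw (n + 1) (false :: x))⁻¹ (Fin.last n) = Fin.last n := by
  rw [Equiv.Perm.inv_eq_iff_eq, gw_last]

/-- Only the trivial rotation fixes the last position. Representatives with the maximum last are
therefore normal forms, and words starting with 0 produce them both for `gw` and for its inverse. -/
theorem eq_of_circ_eq_of_last {n : ℕ} {σ τ : Equiv.Perm (Fin (n + 1))} (h : circ σ = circ τ)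
    (hσ : σ (Fin.last n) = Fin.last n) (hτ : τ (Fin.last n) = Fin.last n) : σ = τ := by
  obtain ⟨j, rfl⟩ := circ_eq_circ_iff.1 h
  rw [Equiv.Perm.mul_apply] at hτ
  have h1 : (finRotate (n + 1) ^ j) (Fin.last n) = Fin.last n := σ.injective (hτ.trans hσ.symm)
  have h2 := coe_finRotate_pow n j (Fin.last n)
  rw [h1, Fin.val_last] at h2
  have h3 : j % (n + 1) = 0 := by
    have h4 : (n + j) % (n + 1) = (n + 0) % (n + 1) := by
      rw [← h2, add_zero, Nat.mod_eq_of_lt (Nat.lt_succ_self n)]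
    exact Nat.ModEq.add_left_cancel' n h4
  have h4 : finRotate (n + 1) ^ j = 1 := by
    ext i
    rw [coe_finRotate_pow, Nat.add_mod, h3]
    simp [Nat.mod_eq_of_lt i.isLt]
  rw [h4, mul_one]

theorem exists_circ_gw_eq {n : ℕ} {v : List Bool} (hv : v.length = n + 1) :
    ∃ x : List Bool, x.length = n ∧ circ (gw (n + 1) v) = circ (gw (n + 1) (false :: x)) := by
  match v, hv with
  | false :: x, hv => exact ⟨x, by simpa using hv, rfl⟩
  | true :: x, hv =>
    refine ⟨x.map (!·), by simpa using hv, ?_⟩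
    rw [← circ_gw_map_not hv]
    simp

theorem exists_eq_replicate_append (b : Bool) (v : List Bool) :
    ∃ (i : ℕ) (x : List Bool), v = List.replicate i b ++ x ∧ (x = [] ∨ ∃ y, x = (!b) :: y) := by
  induction v with
  | nil => exact ⟨0, [], rfl, Or.inl rfl⟩
  | cons c v ih =>
    by_cases h : c = b
    · obtain ⟨i, x, rfl, hx⟩ := ih
      exact ⟨i + 1, x, by simp [h, List.replicate_succ], hx⟩
    · exact ⟨0, c :: v, rfl, Or.inr ⟨v, by cases b <;> cases c <;> simp_all⟩⟩

theorem exists_circ_gw_inv_eq {n : ℕ} {v : List Bool} (hv : v.length = n + 1) :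
    ∃ x : List Bool, x.length = n ∧
      circ (gw (n + 1) v)⁻¹ = circ (gw (n + 1) (false :: x))⁻¹ := by
  obtain ⟨i, x, rfl, hx⟩ := exists_eq_replicate_append true v
  simp only [List.length_append, List.length_replicate] at hv
  rw [circ_gw_inv_shift_replicate hv]
  rcases hx with rfl | ⟨y, rfl⟩
  · simp only [List.length_nil, add_zero] at hv
    subst hv
    exact ⟨List.replicate n false, by simp, by simp [List.replicate_succ]⟩
  · refine ⟨y ++ List.replicate i false, ?_, rfl⟩
    simp at hv ⊢
    omega

/-- A permutation other than the identity has a descent, and a descent can only occur at the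
boundary between the blocks. It thus fixes which positions carry the label `true`. -/
theorem grass_injective {n : ℕ} {f g : Fin n → Bool} (h : grass f = grass g) (h1 : grass f ≠ 1) :
    f = g := by
  rcases n with _ | n
  · exact Subsingleton.elim _ _
  have h2 : ∃ i : Fin n, grass f i.succ < grass f i.castSucc := by
    by_contra! hc
    refine h1 (Equiv.ext fun i => ?_)
    have : StrictMono (grass f) := Fin.strictMono_iff_lt_succ.2 fun i =>
      lt_of_le_of_ne (hc i) fun hh => (Fin.castSucc_lt_succ (i := i)).ne ((grass f).injective hh)
    have h3 := Subsingleton.elim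
      (this.orderIsoOfSurjective _ (grass f).surjective) (OrderIso.refl _)
    exact DFunLike.congr_fun h3 i
  obtain ⟨i, hi⟩ := h2
  have key : ∀ f' : Fin (n + 1) → Bool, grass f' = grass f → ∀ k, f' (grass f k) =
      decide (k ≤ i.castSucc) := by
    intro f' hf' k
    have h3 := grass_spec f' (Fin.castSucc_lt_succ (i := i))
    rw [hf'] at h3
    have h4 := h3.resolve_left fun hh => lt_asymm hh.2 hi
    by_cases hk : k ≤ i.castSucc
    · rcases hk.eq_or_lt with rfl | hk'
      · simp [h4.1]
      · have := grass_spec f' hk'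
        rw [hf'] at this
        simp_all
    · have hk' : i.succ ≤ k := Fin.castSucc_lt_iff_succ_le.1 (not_le.1 hk)
      rcases hk'.eq_or_lt with rfl | hk'
      · simp [h4.2]
      · have := grass_spec f' hk'
        rw [hf'] at this
        simp_all
  funext v
  have e1 := key f rfl ((grass f)⁻¹ v)
  have e2 := key g h.symm ((grass f)⁻¹ v)
  rw [← Equiv.Perm.mul_apply, mul_inv_cancel, Equiv.Perm.one_apply] at e1 e2
  rw [e1, e2]

theorem gw_ne_one {n : ℕ} {w : List Bool} (hw : w.length = n)
    (h : [false, true, false].Sublist w) : gw n w ≠ 1 := by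
  obtain ⟨e, he, h'⟩ := (exists_sublist_iff hw (fun f => f = label 3 [false, true, false])).2
    ⟨_, rfl, h, rfl⟩
  intro h1
  have h01 : e 0 < e 1 := he (by decide)
  have := grass_spec (label n w) h01
  rw [gw] at h1
  have e0 : label n w (e 0) = false := congrFun h' 0
  have e1 : label n w (e 1) = true := congrFun h' 1
  simp [h1, e0, e1] at this

theorem gw_injective {n : ℕ} {v w : List Bool} (hv : v.length = n) (hw : w.length = n)
    (h : [false, true, false].Sublist w) (he : gw n v = gw n w) : v = w :=
  (label_injective hw hv (grass_injective he.symm (gw_ne_one hw h))).symm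

theorem circ_gw_eq_iff {n : ℕ} {v x : List Bool} (hv : v.length = n + 1) (hx : x.length = n)
    (h : [false, true, false].Sublist (false :: x)) :
    circ (gw (n + 1) v) = circ (gw (n + 1) (false :: x)) ↔
      v = false :: x ∨ v = (false :: x).map (!·) := by
  have key : ∀ y : List Bool, y.length = n →
      circ (gw (n + 1) (false :: y)) = circ (gw (n + 1) (false :: x)) → y = x := by
    intro y hy he
    have := gw_injective (by simp [hy]) (by simp [hx]) h
      (eq_of_circ_eq_of_last he (gw_last _) (gw_last _))
    simpa using this
  constructor
  · intro he
    match v, hv with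
    | false :: y, hv =>
      left
      rw [key y (by simpa using hv) he]
    | true :: y, hv =>
      right
      rw [← circ_gw_map_not hv] at he
      rw [← key (y.map (!·)) (by simpa using hv) he]
      simp [Function.comp_def]
  · rintro (rfl | rfl)
    · rfl
    · rw [circ_gw_map_not (by simp [hx])]

/-- Any word becomes a normal form by moving its leading ones to the end as zeros. Undoing this on
`N` followed by zeros can only draw on the final block of zeros, because `N` ends in 1. -/
theorem circ_gw_inv_eq_iff {n m : ℕ} {v N : List Bool} (hv : v.length = n + 1)
    (hN : N.length + m = n + 1)
    (h : [false, true, false].Sublist (N ++ List.replicate m false))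
    (hf : N.head? = some false) (hl : N.getLast? = some true) :
    circ (gw (n + 1) v)⁻¹ = circ (gw (n + 1) (N ++ List.replicate m false))⁻¹ ↔
      ∃ i j, i + j = m ∧ v = List.replicate i true ++ (N ++ List.replicate j false) := by
  obtain ⟨N', rfl⟩ : ∃ N', N = false :: N' := by
    cases N with
    | nil => simp at hf
    | cons a N => exact ⟨N, by simp at hf; rw [hf]⟩
  constructor
  · intro he
    obtain ⟨i, x, rfl, hx⟩ := exists_eq_replicate_append true v
    have hv' := hv
    simp only [List.length_append, List.length_replicate] at hv'
    rw [circ_gw_inv_shift_replicate hv'] at he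
    have hx' : ∃ y, x ++ List.replicate i false = false :: y := by
      rcases hx with rfl | ⟨y, rfl⟩
      · simp only [List.length_nil, add_zero] at hv'
        subst hv'
        exact ⟨List.replicate n false, by simp [List.replicate_succ]⟩
      · exact ⟨_, rfl⟩
    obtain ⟨y, hy⟩ := hx'
    have e : x ++ List.replicate i false = false :: N' ++ List.replicate m false := by
      refine gw_injective (n := n + 1) (by simp; omega) (by simp at hN ⊢; omega) h ?_
      rw [hy] at he ⊢
      exact inv_injective (eq_of_circ_eq_of_last he (gw_inv_last _) (gw_inv_last _))
    -- If more than `m` zeros had been appended, cancelling `m` of them would leave `N` ending in 0.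
    have him : i ≤ m := by
      by_contra hc
      obtain ⟨d, rfl⟩ : ∃ d, i = d + 1 + m := ⟨i - m - 1, by omega⟩
      rw [List.replicate_add, ← List.append_assoc] at e
      have e' := List.append_cancel_right e
      rw [← e', List.replicate_succ', ← List.append_assoc] at hl
      simp at hl
    refine ⟨i, m - i, by omega, ?_⟩
    have e2 : List.replicate m false = List.replicate (m - i) false ++ List.replicate i false := by
      rw [← List.replicate_add]
      congr 1
      omega
    rw [e2, ← List.append_assoc] at e
    rw [List.append_cancel_right e]
  · rintro ⟨i, j, rfl, rfl⟩
    rw [circ_gw_inv_shift_replicate (by simp at hN ⊢; omega), List.append_assoc,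
      ← List.replicate_add, add_comm j i]

/-! ### Reverse complement -/

/-- The reverse complement of a permutation. -/
def revComp {n : ℕ} (σ : Equiv.Perm (Fin n)) : Equiv.Perm (Fin n) :=
  Fin.revPerm * σ * Fin.revPerm

theorem revComp_apply {n : ℕ} (σ : Equiv.Perm (Fin n)) (i : Fin n) :
    revComp σ i = (σ i.rev).rev := rfl

theorem revComp_revComp {n : ℕ} (σ : Equiv.Perm (Fin n)) : revComp (revComp σ) = σ := by
  ext i
  simp [revComp_apply]

theorem LinContains.revComp {n m : ℕ} {σ : Equiv.Perm (Fin n)} {π : Equiv.Perm (Fin m)}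
    (hc : LinContains σ π) : LinContains (revComp σ) (revComp π) := by
  obtain ⟨h, hm, hl⟩ := hc
  refine ⟨fun i => (h i.rev).rev, fun i j hij => ?_, fun i j => ?_⟩
  · simpa [hm.lt_iff_lt] using hij
  · simp [revComp_apply, hl]

theorem revComp_mul {n : ℕ} (σ τ : Equiv.Perm (Fin n)) :
    revComp (σ * τ) = revComp σ * revComp τ := by
  ext i
  simp [revComp_apply]

theorem revComp_finRotate (n : ℕ) : revComp (finRotate n) = (finRotate n)⁻¹ := by
  rcases n with _ | n
  · exact Subsingleton.elim _ _
  rw [eq_inv_iff_mul_eq_one]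
  ext i
  rw [Equiv.Perm.mul_apply, revComp_apply, Equiv.Perm.one_apply]
  by_cases hi : i = Fin.last n
  · subst hi
    simp
  · have h1 := coe_finRotate_of_ne_last hi
    have h2 : (i : ℕ) < n := Fin.val_lt_last hi
    have h3 : (finRotate (n + 1) i).rev ≠ Fin.last n := by
      intro h
      have := congrArg Fin.val h
      rw [Fin.val_rev, h1] at this
      simp at this
      omega
    rw [Fin.val_rev, coe_finRotate_of_ne_last h3, Fin.val_rev, h1]
    omega

/-- The reverse complement of a circular permutation. -/
def circRevComp {n : ℕ} : CircPerm n → CircPerm n :=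
  Quotient.map' revComp (by
    intro σ τ h
    rw [QuotientGroup.leftRel_apply, Subgroup.mem_zpowers_iff] at h ⊢
    obtain ⟨k, hk⟩ := h
    have : τ = σ * finRotate n ^ k := by rw [hk]; group
    refine ⟨-k, ?_⟩
    have h2 : ∀ k : ℤ, revComp (finRotate n ^ k) = (finRotate n)⁻¹ ^ k := by
      intro k
      let F : Equiv.Perm (Fin n) →* Equiv.Perm (Fin n) := MonoidHom.mk' revComp revComp_mul
      have := map_zpow F (finRotate n) k
      simpa [F, revComp_finRotate] using this
    rw [this, revComp_mul, h2]
    group)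

theorem circRevComp_circ {n : ℕ} (σ : Equiv.Perm (Fin n)) :
    circRevComp (circ σ) = circ (revComp σ) := rfl

theorem circRevComp_circRevComp {n : ℕ} (C : CircPerm n) : circRevComp (circRevComp C) = C := by
  obtain ⟨σ, rfl⟩ := QuotientGroup.mk_surjective C
  rw [circRevComp_circ, circRevComp_circ, revComp_revComp]

theorem Contains.circRevComp {n m : ℕ} {C : CircPerm n} {P : CircPerm m} (h : Contains C P) :
    Contains (circRevComp C) (circRevComp P) := by
  obtain ⟨σ, π, rfl, rfl, hc⟩ := h
  exact ⟨revComp σ, revComp π, rfl, rfl, hc.revComp⟩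

theorem contains_circRevComp_iff {n m : ℕ} {C : CircPerm n} {P : CircPerm m} :
    Contains (circRevComp C) (circRevComp P) ↔ Contains C P :=
  ⟨fun h => by simpa [circRevComp_circRevComp] using h.circRevComp, fun h => h.circRevComp⟩

/-- The two blocks stay increasing but trade places, so letters are complemented; values are
reversed, so the word is reversed. -/
theorem revComp_gw {n : ℕ} {u : List Bool} (hu : u.length = n) :
    revComp (gw n u) = gw n (u.reverse.map (!·)) := by
  have hl : ∀ v : Fin n, label n (u.reverse.map (!·)) v.rev = !(label n u v) := by
    intro v
    rw [label_map_not (by simpa using hu)]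
    subst hu
    simp only [label, Fin.rev_rev]
    rw [List.getD_eq_getElem _ _ (by simp), List.getD_eq_getElem _ _ v.rev.isLt,
      List.getElem_reverse]
    simp only [Fin.val_rev]
    congr 2
    omega
  rw [gw, gw, eq_grass_iff]
  intro i j hij
  have := grass_spec (label n u) (Fin.rev_lt_rev.2 hij)
  rw [revComp_apply, revComp_apply, hl, hl]
  rcases this with ⟨h1, h2⟩ | ⟨h1, h2⟩
  · left
    exact ⟨by rw [h1], Fin.rev_lt_rev.2 h2⟩
  · right
    simp [h1, h2]

theorem circRevComp_perm1432 : circRevComp (circ perm1432) = circ perm1432 := by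
  rw [circRevComp_circ, circ_eq_circ_iff]
  exact ⟨2, by decide⟩

theorem ncard_av_circRevComp {m : ℕ} (n : ℕ) (P : CircPerm m) :
    (Av n (pair1432 (circRevComp P))).ncard = (Av n (pair1432 P)).ncard := by
  have : Av n (pair1432 (circRevComp P)) = circRevComp '' Av n (pair1432 P) := by
    ext C
    simp only [Av, pair1432, Set.mem_insert_iff, Set.mem_singleton_iff, forall_eq_or_imp, forall_eq,
      Set.mem_ofPred_eq, Set.mem_image]
    constructor
    · rintro ⟨h1, h2⟩
      refine ⟨circRevComp C, ⟨?_, ?_⟩, circRevComp_circRevComp C⟩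
      · rwa [← circRevComp_perm1432, contains_circRevComp_iff]
      · rwa [← contains_circRevComp_iff, circRevComp_circRevComp]
    · rintro ⟨D, ⟨h1, h2⟩, rfl⟩
      refine ⟨?_, ?_⟩
      · rwa [← circRevComp_perm1432, contains_circRevComp_iff]
      · rwa [contains_circRevComp_iff]
  rw [this, Set.ncard_image_of_injective]
  exact Function.LeftInverse.injective circRevComp_circRevComp

/-! ### Structure of the circular permutations avoiding [1432] -/

/-- Every inversion straddles the single boundary between the blocks, so two inversions cannot lie
one after the other, even sharing an endpoint. -/
theorem grass_no_disjoint_inversions {n : ℕ} (f : Fin n → Bool) {i j k l : Fin n} (hij : i < j)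
    (hjk : j ≤ k) (hkl : k < l) (h1 : grass f j < grass f i) (h2 : grass f l < grass f k) :
    False := by
  have e1 := (grass_spec f hij).resolve_left fun h => lt_asymm h.2 h1
  have e2 := (grass_spec f hkl).resolve_left fun h => lt_asymm h.2 h2
  rcases hjk.eq_or_lt with rfl | hjk
  · simp_all
  · have := grass_spec f hjk
    simp_all

/-- The cut is made at the first position that is the right end of an inversion. No inversion lies
wholly before it by minimality, and none wholly from it onwards by hypothesis. -/
theorem exists_eq_grass {n : ℕ} {τ : Equiv.Perm (Fin n)}
    (h : ∀ i j k l, i < j → j ≤ k → k < l → τ j < τ i → τ l < τ k → False) :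
    ∃ f, τ = grass f := by
  classical
  by_cases hex : ∃ a : ℕ, ∃ (ha : a < n) (i : Fin n), i < ⟨a, ha⟩ ∧ τ ⟨a, ha⟩ < τ i
  · obtain ⟨ha, s, hs, hs'⟩ := Nat.find_spec hex
    refine ⟨fun v => decide ((τ⁻¹ v : Fin n) < (⟨Nat.find hex, ha⟩ : Fin n)), ?_⟩
    rw [eq_grass_iff]
    intro i j hij
    have hinv : ∀ x, τ⁻¹ (τ x) = x := fun x => by simp
    simp only [hinv]
    by_cases hj : j < (⟨Nat.find hex, ha⟩ : Fin n)
    · left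
      refine ⟨by simp [hj, hij.trans hj], ?_⟩
      by_contra hc
      have hc' : τ j < τ i := lt_of_le_of_ne (not_lt.1 hc) fun h => hij.ne' (τ.injective h)
      exact Nat.find_min hex hj ⟨j.isLt, i, hij, hc'⟩
    · by_cases hi : i < (⟨Nat.find hex, ha⟩ : Fin n)
      · right
        simp [hi, not_lt.1 hj]
      · left
        refine ⟨by simp [hi, hj], ?_⟩
        by_contra hc
        have hc' : τ j < τ i := lt_of_le_of_ne (not_lt.1 hc) fun h => hij.ne' (τ.injective h)
        exact h _ _ _ _ hs (not_lt.1 hi) hij hs' hc'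
  · refine ⟨fun _ => true, eq_grass_iff.2 fun i j hij => Or.inl ⟨rfl, ?_⟩⟩
    by_contra hc
    exact hex ⟨j, j.isLt, i, hij, lt_of_le_of_ne (not_lt.1 hc) fun h => hij.ne' (τ.injective h)⟩

theorem exists_gw_eq_grass {n : ℕ} (f : Fin n → Bool) :
    ∃ u : List Bool, u.length = n ∧ gw n u = grass f := by
  refine ⟨List.ofFn fun i : Fin n => f i.rev, by simp, ?_⟩
  rw [gw]
  congr 1
  funext v
  rw [label, List.getD_eq_getElem _ _ (by rw [List.length_ofFn]; exact v.rev.isLt),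
    List.getElem_ofFn]
  simp only [Fin.eta, Fin.rev_rev]

/-- The permutation `3214`. -/
def perm3214 : Equiv.Perm (Fin 4) :=
  ⟨![2, 1, 0, 3], ![2, 1, 0, 3], by decide, by decide⟩

/-- The permutation `2143`. -/
def perm2143 : Equiv.Perm (Fin 4) :=
  ⟨![1, 0, 3, 2], ![1, 0, 3, 2], by decide, by decide⟩

/-- The permutation `24135`. -/
def perm24135 : Equiv.Perm (Fin 5) :=
  ⟨![1, 3, 0, 2, 4], ![2, 0, 3, 1, 4], by decide, by decide⟩

theorem circ_perm3214 : circ perm3214 = circ perm1432 :=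
  (circ_eq_circ_iff.2 ⟨2, by decide⟩).symm

theorem circ_perm2143 : circ perm2143 = circ perm1432 :=
  (circ_eq_circ_iff.2 ⟨3, by decide⟩).symm

theorem gw_five_alternating : gw 5 [false, true, false, true, false] = perm24135 := by
  symm
  rw [gw, eq_grass_iff]
  decide

/-- The subword 01010 puts the inverse 31425 of 24135 inside the left side. Its inversions 31 and 42
are disjoint, so it is no sorted two-block permutation; but all patterns in the right side are, up
to rotation. -/
theorem circ_gw_inv_ne_circ_gw {n : ℕ} {v w : List Bool} (hv : v.length = n) (hw : w.length = n)
    (h : [false, true, false, true, false].Sublist w) : circ (gw n w)⁻¹ ≠ circ (gw n v) := by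
  intro he
  have h1 : Contains (circ (gw n w)⁻¹) (circ (gw 5 [false, true, false, true, false])⁻¹) :=
    (contains_circ_gw_inv_iff hw _).2 ⟨_, rfl, h, rfl⟩
  rw [he, contains_circ_gw_iff hv] at h1
  obtain ⟨v', hv', -, he'⟩ := h1
  obtain ⟨x, hx, hx'⟩ := exists_circ_gw_eq hv'
  have h2 := eq_of_circ_eq_of_last (hx'.symm.trans he') (gw_last _) (gw_inv_last _)
  rw [gw_five_alternating] at h2
  have h3 := @grass_no_disjoint_inversions 5 (label 5 (false :: x)) 0 1 2 3
    (by decide) (by decide) (by decide)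
  rw [← gw, h2] at h3
  exact h3 (by decide) (by decide)

theorem circ_gw_ne_circ_gw_inv {n : ℕ} {v w : List Bool} (hv : v.length = n) (hw : w.length = n)
    (h : [false, true, false, true, false].Sublist w) : circ (gw n w) ≠ circ (gw n v)⁻¹ := by
  intro he
  have h1 : Contains (circ (gw n w)) (circ (gw 5 [false, true, false, true, false])) :=
    (contains_circ_gw_iff hw _).2 ⟨_, rfl, h, rfl⟩
  rw [he, contains_circ_gw_inv_iff hv] at h1
  obtain ⟨v', hv', -, he'⟩ := h1
  obtain ⟨x, hx, hx'⟩ := exists_circ_gw_inv_eq hv'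
  have h2 := eq_of_circ_eq_of_last (hx'.symm.trans he') (gw_inv_last _) (gw_last _)
  rw [gw_five_alternating, inv_eq_iff_eq_inv] at h2
  have h3 := @grass_no_disjoint_inversions 5 (label 5 (false :: x)) 0 1 2 3
    (by decide) (by decide) (by decide)
  rw [← gw, h2] at h3
  exact h3 (by decide) (by decide)

theorem gw_four_ne_perm3214 (u : List Bool) : gw 4 u ≠ perm3214 := by
  intro h2
  have h3 := @grass_no_disjoint_inversions 4 (label 4 u) 0 1 1 2
    (by decide) (by decide) (by decide)
  rw [← gw, h2] at h3
  exact h3 (by decide) (by decide)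

theorem not_contains_gw_perm1432 {n : ℕ} {u : List Bool} (hu : u.length = n) :
    ¬ Contains (circ (gw n u)) (circ perm1432) := by
  rw [contains_circ_gw_iff hu, ← circ_perm3214]
  rintro ⟨v, hv, -, he⟩
  obtain ⟨x, hx, hx'⟩ := exists_circ_gw_eq hv
  exact gw_four_ne_perm3214 _ (eq_of_circ_eq_of_last (hx'.symm.trans he) (gw_last _) rfl)

theorem not_contains_gw_inv_perm1432 {n : ℕ} {u : List Bool} (hu : u.length = n) :
    ¬ Contains (circ (gw n u)⁻¹) (circ perm1432) := by
  rw [contains_circ_gw_inv_iff hu, ← circ_perm3214]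
  rintro ⟨v, hv, -, he⟩
  obtain ⟨x, hx, hx'⟩ := exists_circ_gw_inv_eq hv
  have := eq_of_circ_eq_of_last (hx'.symm.trans he) (gw_inv_last _) rfl
  rw [inv_eq_iff_eq_inv] at this
  exact gw_four_ne_perm3214 _ this

theorem linContains_of_positions {n m : ℕ} {σ : Equiv.Perm (Fin n)} {π : Equiv.Perm (Fin m)}
    (h : Fin m → Fin n) (hm : StrictMono h) (hl : ∀ i j, π i < π j → σ (h i) < σ (h j)) :
    LinContains σ π := by
  refine ⟨h, hm, fun i j => ⟨fun hij => ?_, hl i j⟩⟩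
  by_contra hc
  rcases (not_lt.1 hc).eq_or_lt with e | e
  · rw [π.injective e] at hij
    exact lt_irrefl _ hij
  · exact lt_asymm hij (hl _ _ e)

/-- A permutation avoiding `321` and `2143` has no two inversions with disjoint position intervals
or no two inversions with disjoint value intervals. -/
theorem disjoint_inversions_false {n : ℕ} {σ : Fin n → Fin n} (hσ : Function.Injective σ)
    (h321 : ∀ i j k, i < j → j < k → σ j < σ i → σ k < σ j → False)
    (h2143 : ∀ i j k l, i < j → j < k → k < l → σ j < σ i → σ i < σ l → σ l < σ k → False)
    {u₁ l₁ u₂ l₂ u₃ l₃ u₄ l₄ : Fin n}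
    (p₁ : u₁ < l₁) (v₁ : σ l₁ < σ u₁) (p₂ : u₂ < l₂) (v₂ : σ l₂ < σ u₂)
    (p₃ : u₃ < l₃) (v₃ : σ l₃ < σ u₃) (p₄ : u₄ < l₄) (v₄ : σ l₄ < σ u₄)
    (hp : l₁ ≤ u₂) (hv : σ u₃ ≤ σ l₄) : False := by
  have hp' : l₁ < u₂ := lt_of_le_of_ne hp fun h => h321 u₁ l₁ l₂ p₁ (h ▸ p₂) v₁ (h ▸ v₂)
  have hv' : σ u₃ < σ l₄ := lt_of_le_of_ne hv fun h => by
    have := hσ h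
    subst this
    exact h321 u₄ u₃ l₃ p₄ p₃ v₄ v₃
  -- By avoidance of 321, the tops of inversions form an increasing sequence, and so do the bottoms.
  -- Comparing positions therefore also compares values.
  have hup : ∀ u l u' l', u < l → σ l < σ u → u' < l' → σ l' < σ u' → u ≤ u' → σ u ≤ σ u' := by
    intro u l u' l' _ _ h3 h4 h5
    by_contra hc
    rcases h5.eq_or_lt with rfl | h5
    · exact hc le_rfl
    · exact h321 u u' l' h5 h3 (not_le.1 hc) h4
  have hlow : ∀ u l u' l', u < l → σ l < σ u → u' < l' → σ l' < σ u' → l ≤ l' → σ l ≤ σ l' := by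
    intro u l u' l' h1 h2 _ _ h5
    by_contra hc
    rcases h5.eq_or_lt with rfl | h5
    · exact hc le_rfl
    · exact h321 u l l' h1 h5 h2 (not_le.1 hc)
  -- The earlier top and the earlier bottom from inversions 1 and 3, and the later ones from 2 and
  -- 4, form a 2143: `hp'` separates them in position and `hv'` in value.
  obtain ⟨u, hu, a1, a2, a3⟩ : ∃ u, (u = u₁ ∨ u = u₃) ∧ u ≤ u₁ ∧ u ≤ u₃ ∧
      σ u ≤ σ u₁ ∧ σ u ≤ σ u₃ := by
    rcases le_total u₁ u₃ with h | h
    · exact ⟨u₁, Or.inl rfl, le_rfl, h, le_rfl, hup _ _ _ _ p₁ v₁ p₃ v₃ h⟩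
    · exact ⟨u₃, Or.inr rfl, h, le_rfl, hup _ _ _ _ p₃ v₃ p₁ v₁ h, le_rfl⟩
  obtain ⟨l, hl, b1, b2, b3⟩ : ∃ l, (l = l₁ ∨ l = l₃) ∧ l ≤ l₁ ∧ l ≤ l₃ ∧
      σ l ≤ σ l₁ ∧ σ l ≤ σ l₃ := by
    rcases le_total l₁ l₃ with h | h
    · exact ⟨l₁, Or.inl rfl, le_rfl, h, le_rfl, hlow _ _ _ _ p₁ v₁ p₃ v₃ h⟩
    · exact ⟨l₃, Or.inr rfl, h, le_rfl, hlow _ _ _ _ p₃ v₃ p₁ v₁ h, le_rfl⟩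
  obtain ⟨U, hU, c1, c2, c3⟩ : ∃ u, (u = u₂ ∨ u = u₄) ∧ u₂ ≤ u ∧ u₄ ≤ u ∧
      σ u₂ ≤ σ u ∧ σ u₄ ≤ σ u := by
    rcases le_total u₂ u₄ with h | h
    · exact ⟨u₄, Or.inr rfl, h, le_rfl, hup _ _ _ _ p₂ v₂ p₄ v₄ h, le_rfl⟩
    · exact ⟨u₂, Or.inl rfl, le_rfl, h, le_rfl, hup _ _ _ _ p₄ v₄ p₂ v₂ h⟩
  obtain ⟨L, hL, d1, d2, d3⟩ : ∃ l, (l = l₂ ∨ l = l₄) ∧ l₂ ≤ l ∧ l₄ ≤ l ∧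
      σ l₂ ≤ σ l ∧ σ l₄ ≤ σ l := by
    rcases le_total l₂ l₄ with h | h
    · exact ⟨l₄, Or.inr rfl, h, le_rfl, hlow _ _ _ _ p₂ v₂ p₄ v₄ h, le_rfl⟩
    · exact ⟨l₂, Or.inl rfl, le_rfl, h, le_rfl, hlow _ _ _ _ p₄ v₄ p₂ v₂ h⟩
  refine h2143 u l U L ?_ (b1.trans_lt (hp'.trans_le c1)) ?_ ?_
    (a3.2.trans_lt (hv'.trans_le d3.2)) ?_
  · rcases hl with rfl | rfl
    · exact a1.trans_lt p₁
    · exact a2.trans_lt p₃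
  · rcases hU with rfl | rfl
    · exact p₂.trans_le d1
    · exact p₄.trans_le d2
  · rcases hu with rfl | rfl
    · exact b3.1.trans_lt v₁
    · exact b3.2.trans_lt v₃
  · rcases hL with rfl | rfl
    · exact v₂.trans_le c3.1
    · exact v₄.trans_le c3.2

theorem exists_circ_eq_last {n : ℕ} (σ : Equiv.Perm (Fin (n + 1))) :
    ∃ τ : Equiv.Perm (Fin (n + 1)), circ σ = circ τ ∧ τ (Fin.last n) = Fin.last n := by
  refine ⟨σ * finRotate (n + 1) ^ ((σ⁻¹ (Fin.last n) : ℕ) + 1), circ_eq_circ_iff.2 ⟨_, rfl⟩, ?_⟩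
  have : (finRotate (n + 1) ^ ((σ⁻¹ (Fin.last n) : ℕ) + 1)) (Fin.last n) = σ⁻¹ (Fin.last n) := by
    apply Fin.ext
    rw [coe_finRotate_pow, Fin.val_last]
    have e : n + (((σ⁻¹ (Fin.last n) : Fin (n + 1)) : ℕ) + 1) =
      ((σ⁻¹ (Fin.last n) : Fin (n + 1)) : ℕ) + (n + 1) := by omega
    rw [e, Nat.add_mod_right, Nat.mod_eq_of_lt (Fin.isLt _)]
  rw [Equiv.Perm.mul_apply, this, ← Equiv.Perm.mul_apply, mul_inv_cancel, Equiv.Perm.one_apply]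

theorem strictMono_vecCons_four {n : ℕ} {i j k l : Fin n} (h1 : i < j) (h2 : j < k) (h3 : k < l) :
    StrictMono ![i, j, k, l] := by
  rw [Fin.strictMono_iff_lt_succ]
  intro a
  fin_cases a
  · exact h1
  · exact h2
  · exact h3

/-- The circular permutations avoiding `[1432]`. -/
theorem exists_word_of_not_contains_perm1432 {n : ℕ} (σ : Equiv.Perm (Fin (n + 1)))
    (hav : ¬ Contains (circ σ) (circ perm1432)) :
    ∃ x : List Bool, x.length = n ∧ (circ σ = circ (gw (n + 1) (false :: x)) ∨
      circ σ = circ (gw (n + 1) (false :: x))⁻¹) := by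
  obtain ⟨τ, hτ, hlast⟩ := exists_circ_eq_last σ
  rw [hτ] at hav ⊢
  -- The final maximum extends a 321 to a 3214.
  have h321 : ∀ i j k, i < j → j < k → τ j < τ i → τ k < τ j → False := by
    intro i j k h1 h2 h3 h4
    have hk : k < Fin.last n := by
      refine lt_of_le_of_ne (Fin.le_last _) ?_
      rintro rfl
      rw [hlast] at h4
      exact absurd h4 (not_lt.2 (Fin.le_last _))
    have hi : τ i < τ (Fin.last n) := by
      rw [hlast]
      refine lt_of_le_of_ne (Fin.le_last _) fun h => ?_
      exact (h1.trans (h2.trans hk)).ne (τ.injective (h.trans hlast.symm))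
    refine hav ((contains_circ_iff_exists_pattern _ _).2 ⟨perm3214, circ_perm3214,
      linContains_of_positions ![i, j, k, Fin.last n] (strictMono_vecCons_four h1 h2 hk) ?_⟩)
    have h5 := h4.trans h3
    have h6 := h3.trans hi
    have h7 := h4.trans h6
    intro a b hab
    fin_cases a <;> fin_cases b <;>
      first | (exact absurd hab (by decide)) | assumption
  have h2143 : ∀ i j k l, i < j → j < k → k < l → τ j < τ i → τ i < τ l → τ l < τ k → False := by
    intro i j k l h1 h2 h3 h4 h5 h6
    refine hav ((contains_circ_iff_exists_pattern _ _).2 ⟨perm2143, circ_perm2143,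
      linContains_of_positions ![i, j, k, l] (strictMono_vecCons_four h1 h2 h3) ?_⟩)
    have h7 := h4.trans h5
    have h8 := h5.trans h6
    have h9 := h4.trans h8
    intro a b hab
    fin_cases a <;> fin_cases b <;>
      first | (exact absurd hab (by decide)) | assumption
  by_cases hG : ∃ f, τ = grass f
  · obtain ⟨f, rfl⟩ := hG
    obtain ⟨u, hu, hu'⟩ := exists_gw_eq_grass f
    obtain ⟨x, hx, hx'⟩ := exists_circ_gw_eq hu
    exact ⟨x, hx, Or.inl (by rw [← hx', hu'])⟩
  by_cases hI : ∃ f, τ⁻¹ = grass f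
  · obtain ⟨f, hf⟩ := hI
    obtain ⟨u, hu, hu'⟩ := exists_gw_eq_grass f
    obtain ⟨x, hx, hx'⟩ := exists_circ_gw_inv_eq hu
    exact ⟨x, hx, Or.inr (by rw [← hx', hu', ← hf, inv_inv])⟩
  exfalso
  -- If neither `τ` nor its inverse has the block form, there are two inversions disjoint in
  -- position and two disjoint in value.
  refine hG (exists_eq_grass fun u₁ l₁ u₂ l₂ p₁ hp p₂ v₁ v₂ => ?_)
  refine hI (exists_eq_grass fun l₃ u₃ l₄ u₄ v₃ hv v₄ p₃ p₄ => ?_)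
  exact disjoint_inversions_false τ.injective h321 h2143 p₁ v₁ p₂ v₂ p₃ (by simpa using v₃) p₄
    (by simpa using v₄) hp (by simpa using hv)

/-! ### Words with at most four runs, where G and IG overlap -/

/-- The map exchanging two adjacent blocks of `b` and `c` numbers after `d` fixed points. -/
def blockSwapFun (b c d i : ℕ) : ℕ :=
  if i < d then i else if i < d + b then i + c else if i < d + b + c then i - b else i

theorem blockSwapFun_spec (b c d i : ℕ) :
    (i < d ∧ blockSwapFun b c d i = i) ∨
    (d ≤ i ∧ i < d + b ∧ blockSwapFun b c d i = i + c) ∨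
    (d + b ≤ i ∧ i < d + b + c ∧ blockSwapFun b c d i = i - b) ∨
    (d + b + c ≤ i ∧ blockSwapFun b c d i = i) := by
  unfold blockSwapFun
  split_ifs <;> omega

theorem blockSwapFun_blockSwapFun (b c d i : ℕ) :
    blockSwapFun c b d (blockSwapFun b c d i) = i := by
  have := blockSwapFun_spec b c d i
  have := blockSwapFun_spec c b d (blockSwapFun b c d i)
  omega

/-- The permutation exchanging two adjacent blocks. -/
def blockSwap {n : ℕ} (b c d : ℕ) (h : b + c + d ≤ n) : Equiv.Perm (Fin n) where
  toFun i := ⟨blockSwapFun b c d i, by have := blockSwapFun_spec b c d i; omega⟩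
  invFun i := ⟨blockSwapFun c b d i, by have := blockSwapFun_spec c b d i; omega⟩
  left_inv i := Fin.ext (blockSwapFun_blockSwapFun b c d i)
  right_inv i := Fin.ext (blockSwapFun_blockSwapFun c b d i)

theorem label_four_runs {n : ℕ} (a b c d : ℕ) (hn : a + b + c + d = n) (v : Fin n) :
    label n (List.replicate a false ++ (List.replicate b true ++ (List.replicate c false ++
      List.replicate d true))) v =
    decide ((v : ℕ) < d ∨ (d + c ≤ v ∧ (v : ℕ) < d + c + b)) := by
  have hv := v.isLt
  rw [label, List.getD_eq_getElem _ _ (by simp; omega)]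
  simp only [List.getElem_append, List.getElem_replicate, List.length_replicate, Fin.val_rev]
  symm
  split_ifs <;> simp only [decide_eq_true_eq, decide_eq_false_iff_not] <;> omega

/-- The lowest `d` values have label `true` and the highest `a` have label `false`, so both groups
are fixed. In between, the `b` upper values labelled `true` jump over the `c` lower ones. -/
theorem gw_four_runs {n : ℕ} (a b c d : ℕ) (hn : a + b + c + d = n) :
    gw n (List.replicate a false ++ (List.replicate b true ++
      (List.replicate c false ++ List.replicate d true))) = blockSwap b c d (by omega) := by
  symm
  rw [gw, eq_grass_iff]
  intro i j hij
  rw [label_four_runs _ _ _ _ hn, label_four_runs _ _ _ _ hn]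
  have h1 : (blockSwap b c d (by omega : b + c + d ≤ n) i : ℕ) = blockSwapFun b c d i := rfl
  have h2 : (blockSwap b c d (by omega : b + c + d ≤ n) j : ℕ) = blockSwapFun b c d j := rfl
  rw [Fin.lt_def] at *
  rw [h1, h2, decide_eq_decide, decide_eq_true_eq, decide_eq_false_iff_not]
  have h3 := blockSwapFun_spec b c d i
  have h4 := blockSwapFun_spec b c d j
  clear h1 h2
  generalize blockSwapFun b c d i = p at *
  generalize blockSwapFun b c d j = q at *
  omega

theorem gw_inv_four_runs {n : ℕ} (a b c d : ℕ) (hn : a + b + c + d = n) :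
    (gw n (List.replicate a false ++ (List.replicate b true ++
      (List.replicate c false ++ List.replicate d true))))⁻¹ =
    gw n (List.replicate a false ++ (List.replicate c true ++
      (List.replicate b false ++ List.replicate d true))) := by
  rw [gw_four_runs _ _ _ _ hn, gw_four_runs _ _ _ _ (by omega)]
  rfl

/-! ### Run sizes and subwords -/

theorem finite_words (n : ℕ) (p : List Bool → Prop) : {u : List Bool | u.length = n ∧ p u}.Finite :=
  (List.finite_length_eq Bool n).subset fun _ hu => hu.1

theorem cons_sublist_replicate_append {x y : Bool} {w u : List Bool} {n : ℕ} (hxy : x ≠ y)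
    (h : (x :: w).Sublist (List.replicate n y ++ u)) : (x :: w).Sublist u := by
  induction n with
  | zero => simpa using h
  | succ n ih =>
    rw [List.replicate_succ, List.cons_append, List.sublist_cons_iff] at h
    rcases h with h | ⟨r, hr, -⟩
    · exact ih h
    · simp only [List.cons.injEq] at hr
      exact absurd hr.1 hxy

theorem replicate_append_sublist_replicate_append {x : Bool} {w u : List Bool} {a a' : ℕ}
    (h : (List.replicate a x ++ w).Sublist (List.replicate a' x ++ u)) :
    (a ≤ a' ∧ w.Sublist (List.replicate (a' - a) x ++ u)) ∨
      (a' < a ∧ (List.replicate (a - a') x ++ w).Sublist u) := by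
  induction a generalizing a' with
  | zero => left; simpa using h
  | succ a ih =>
    cases a' with
    | zero => right; simpa using h
    | succ a' =>
      rw [List.replicate_succ, List.replicate_succ, List.cons_append, List.cons_append,
        List.cons_sublist_cons] at h
      rcases ih h with ⟨h1, h2⟩ | ⟨h1, h2⟩
      · left
        exact ⟨by omega, by rwa [Nat.add_sub_add_right]⟩
      · right
        exact ⟨by omega, by rwa [Nat.add_sub_add_right]⟩

theorem length_wordFrom (b : Bool) (l : List ℕ) : (wordFrom b l).length = l.sum := by
  induction l generalizing b with
  | nil => rfl
  | cons n l ih => simp [wordFrom, ih]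

theorem length_B (l : List ℕ) : (B l).length = l.sum := length_wordFrom _ _

theorem map_not_wordFrom (b : Bool) (l : List ℕ) :
    (wordFrom b l).map (!·) = wordFrom (!b) l := by
  induction l generalizing b with
  | nil => rfl
  | cons n l ih => simp [wordFrom, ih]

theorem wordFrom_append (b : Bool) (l l' : List ℕ) :
    wordFrom b (l ++ l') = wordFrom b l ++ wordFrom (not^[l.length] b) l' := by
  induction l generalizing b with
  | nil => rfl
  | cons n l ih => simp [wordFrom, ih]

theorem not_iterate_even {n : ℕ} (h : Even n) (b : Bool) : not^[n] b = b := by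
  obtain ⟨m, rfl⟩ := h
  induction m with
  | zero => rfl
  | succ m ih =>
    have : m + 1 + (m + 1) = (m + m) + 2 := by omega
    rw [this, Function.iterate_add_apply]
    simpa using ih

theorem reverse_wordFrom (b : Bool) (l : List ℕ) :
    (wordFrom b l).reverse = wordFrom (not^[l.length + 1] b) l.reverse := by
  induction l generalizing b with
  | nil => rfl
  | cons n l ih =>
    rw [wordFrom, List.reverse_append, ih, List.reverse_cons, wordFrom_append, List.length_cons,
      List.reverse_replicate]
    have h1 : not^[l.length + 1] (!b) = not^[l.length + 1 + 1] b := rfl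
    have h2 : not^[l.reverse.length] (not^[l.length + 1 + 1] b) = b := by
      rw [← Function.iterate_add_apply, List.length_reverse]
      exact not_iterate_even ⟨l.length + 1, by omega⟩ b
    rw [h1, h2]
    simp [wordFrom]

theorem B_append_of_even {l : List ℕ} (h : Even l.length) (m : ℕ) :
    B (l ++ [m]) = B l ++ List.replicate m false := by
  rw [B, wordFrom_append, not_iterate_even h]
  simp [wordFrom, B]

theorem wordFrom_cons_of_pos {b : Bool} {n : ℕ} {l : List ℕ} (hn : 1 ≤ n) :
    wordFrom b (n :: l) = b :: (List.replicate (n - 1) b ++ wordFrom (!b) l) := by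
  obtain ⟨n, rfl⟩ : ∃ n', n = n' + 1 := ⟨n - 1, by omega⟩
  simp [wordFrom, List.replicate_succ]

theorem exists_eq_wordFrom (w : List Bool) :
    ∃ b l, (∀ x ∈ l, 1 ≤ x) ∧ w = wordFrom b l := by
  induction w with
  | nil => exact ⟨false, [], by simp, rfl⟩
  | cons c w ih =>
    obtain ⟨b, l, hl, rfl⟩ := ih
    cases l with
    | nil => exact ⟨c, [1], by simp, rfl⟩
    | cons n l =>
      by_cases h : c = b
      · subst h
        exact ⟨c, (n + 1) :: l, by simp at hl ⊢; exact hl.2,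
          by simp [wordFrom, List.replicate_succ]⟩
      · have h' : b = !c := by cases b <;> cases c <;> simp_all
        subst h'
        exact ⟨c, 1 :: n :: l, by simp at hl ⊢; exact hl, by simp [wordFrom]⟩

theorem exists_eq_B (x : List Bool) :
    ∃ l, l ≠ [] ∧ (∀ x ∈ l, 1 ≤ x) ∧ false :: x = B l := by
  obtain ⟨b, l, hl, hw⟩ := exists_eq_wordFrom (false :: x)
  cases l with
  | nil => simp [wordFrom] at hw
  | cons n l =>
    have h := hw
    rw [wordFrom_cons_of_pos (hl n (by simp))] at h
    simp only [List.cons.injEq] at h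
    rw [← h.1] at hw
    exact ⟨n :: l, by simp, hl, hw⟩

theorem exists_B_eq_cons {l : List ℕ} (h0 : l ≠ []) (hl : ∀ x ∈ l, 1 ≤ x) :
    ∃ x, B l = false :: x := by
  cases l with
  | nil => exact absurd rfl h0
  | cons n l => exact ⟨_, wordFrom_cons_of_pos (hl n (by simp))⟩

theorem wordFrom_sublist_wordFrom {b : Bool} {l l' : List ℕ} (h : List.Forall₂ (· ≤ ·) l l') :
    (wordFrom b l).Sublist (wordFrom b l') := by
  induction h generalizing b with
  | nil => exact List.Sublist.refl _
  | cons h _ ih =>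
    exact List.Sublist.append (List.replicate_sublist_replicate b |>.2 h) ih

theorem wordFrom_ones_sublist {b : Bool} {l : List ℕ} {j : ℕ} (hl : ∀ x ∈ l, 1 ≤ x)
    (hj : j ≤ l.length) : (wordFrom b (List.replicate j 1)).Sublist (wordFrom b l) := by
  induction l generalizing b j with
  | nil =>
    simp only [List.length_nil, nonpos_iff_eq_zero] at hj
    subst hj
    exact List.Sublist.refl _
  | cons n l ih =>
    cases j with
    | zero => simp [wordFrom]
    | succ j =>
      rw [List.replicate_succ]
      exact List.Sublist.append ((List.replicate_sublist_replicate b).2 (hl n (by simp)))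
        (ih (fun x hx => hl x (by simp [hx])) (by simpa using hj))

/-- Together with `wordFrom_ones_sublist` this reads the number of runs off the alternating
subwords. -/
theorem le_length_of_wordFrom_ones_sublist {b : Bool} {l : List ℕ} {j : ℕ}
    (h : (wordFrom b (List.replicate j 1)).Sublist (wordFrom b l)) : j ≤ l.length := by
  induction l generalizing b j with
  | nil =>
    have := h.length_le
    rw [length_wordFrom] at this
    simpa [wordFrom] using this
  | cons n l ih =>
    match j with
    | 0 => simp
    | 1 => simp
    | j + 2 =>
      have h1 : ((!b) :: wordFrom b (List.replicate j 1)).Sublist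
          (List.replicate n b ++ wordFrom (!b) l) := by
        have := List.sublist_of_cons_sublist h
        simpa [List.replicate_succ, wordFrom] using this
      have h2 := cons_sublist_replicate_append (by cases b <;> simp) h1
      have h3 := @ih (!b) (j + 1) (by simpa [List.replicate_succ, wordFrom] using h2)
      simp
      omega

/-- With equally many runs an embedding has no slack: a run spilling out of its counterpart skips a
run of the other letter, and then too few runs remain. -/
theorem forall₂_le_of_wordFrom_sublist {b : Bool} {l l' : List ℕ} (hl : ∀ x ∈ l, 1 ≤ x)
    (he : l.length = l'.length) (h : (wordFrom b l).Sublist (wordFrom b l')) :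
    List.Forall₂ (· ≤ ·) l l' := by
  induction l generalizing b l' with
  | nil =>
    cases l' with
    | nil => exact List.Forall₂.nil
    | cons _ _ => simp at he
  | cons a l ih =>
    cases l' with
    | nil => simp at he
    | cons a' l' =>
      have hl' : ∀ x ∈ l, 1 ≤ x := fun x hx => hl x (by simp [hx])
      have he' : l.length = l'.length := by simpa using he
      rcases replicate_append_sublist_replicate_append h with ⟨h1, h2⟩ | ⟨h1, h2⟩
      · refine List.Forall₂.cons h1 (ih hl' he' (b := !b) ?_)
        cases l with
        | nil => simp [wordFrom]
        | cons c l =>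
          rw [wordFrom_cons_of_pos (hl' c (by simp))] at h2 ⊢
          exact cons_sublist_replicate_append (by cases b <;> simp) h2
      -- The spilled run and the rest still make `l.length + 1` runs starting with `b`. They must
      -- skip the first run of `wordFrom (!b) l'`, after which only `l'.length - 1` runs are left.
      · exfalso
        have h3 : (wordFrom b (List.replicate (l.length + 1) 1)).Sublist (wordFrom (!b) l') :=
          (wordFrom_ones_sublist (l := (a - a') :: l) (by
            intro x hx
            rcases List.mem_cons.1 hx with rfl | hx
            · omega
            · exact hl' x hx) (by simp)).trans h2
        cases l' with
        | nil =>
          have := h3.length_le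
          rw [length_wordFrom] at this
          simp [wordFrom] at this
        | cons c l' =>
          rw [List.replicate_succ, wordFrom_cons_of_pos le_rfl, wordFrom] at h3
          have h4 := cons_sublist_replicate_append (by cases b <;> simp) h3
          rw [Bool.not_not] at h4
          have h5 := @le_length_of_wordFrom_ones_sublist b l' (l.length + 1) (by
            rw [List.replicate_succ, wordFrom_cons_of_pos le_rfl]
            exact h4)
          simp only [List.length_cons] at he'
          omega

theorem wordFrom_injective {b : Bool} {l l' : List ℕ} (hl : ∀ x ∈ l, 1 ≤ x)
    (hl' : ∀ x ∈ l', 1 ≤ x) (he : l.length = l'.length) (h : wordFrom b l = wordFrom b l') :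
    l = l' := by
  have h1 := forall₂_le_of_wordFrom_sublist (b := b) hl he (by rw [h])
  have h2 := forall₂_le_of_wordFrom_sublist (b := b) hl' he.symm (by rw [h])
  clear h hl hl' he
  induction h1 with
  | nil => rfl
  | cons h _ ih =>
    cases h2 with
    | cons h' h2 => rw [le_antisymm h h', ih h2]

theorem isChain_replicate_beq (n : ℕ) (b : Bool) :
    (List.replicate n b).IsChain (fun x y => (x == y) = true) := by
  induction n with
  | zero => simp
  | succ n ih =>
    cases n with
    | zero => simp
    | succ n =>
      rw [List.replicate_succ, List.replicate_succ, List.isChain_cons_cons,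
        ← List.replicate_succ]
      exact ⟨by simp, ih⟩

theorem numRuns_wordFrom {b : Bool} {l : List ℕ} (hl : ∀ x ∈ l, 1 ≤ x) :
    numRuns (wordFrom b l) = l.length := by
  induction l generalizing b with
  | nil => rfl
  | cons n l ih =>
    have hn : 1 ≤ n := hl n (by simp)
    have h1 : (List.replicate n b).splitBy (· == ·) = [List.replicate n b] :=
      List.splitBy_of_isChain (by simp; omega) (isChain_replicate_beq n b)
    have ih' := @ih (!b) (fun x hx => hl x (by simp [hx]))
    cases l with
    | nil =>
      simp only [numRuns, wordFrom, List.append_nil, h1]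
      rfl
    | cons m l =>
      rw [wordFrom, wordFrom_cons_of_pos (hl m (by simp)), numRuns, List.splitBy_append_cons]
      · rw [h1, List.length_append]
        rw [wordFrom_cons_of_pos (hl m (by simp)), numRuns] at ih'
        rw [ih']
        simp
        omega
      · intro x hx
        have := List.mem_of_getLast? hx
        rw [List.mem_replicate] at this
        rw [this.2]
        cases b <;> rfl

theorem alternating_wordFrom_iff {b : Bool} {l : List ℕ} (hl : ∀ x ∈ l, 1 ≤ x) :
    Alternating (wordFrom b l) ↔ ∀ x ∈ l, x = 1 := by
  induction l generalizing b with
  | nil => simp [Alternating, wordFrom]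
  | cons n l ih =>
    have hl' : ∀ x ∈ l, 1 ≤ x := fun x hx => hl x (by simp [hx])
    rw [List.forall_mem_cons, ← @ih (!b) hl']
    have hn := hl n (by simp)
    match n, hn with
    | 1, _ =>
      cases l with
      | nil => simp [wordFrom, Alternating]
      | cons m l =>
        rw [wordFrom, wordFrom_cons_of_pos (hl' m (by simp))]
        simp [Alternating]
    | n + 2, _ => simp [wordFrom, Alternating, List.replicate_succ]

theorem zipWith_add_spec {l t : List ℕ} (h : t.length = l.length) :
    List.Forall₂ (· ≤ ·) l (List.zipWith (· + ·) l t) ∧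
      (List.zipWith (· + ·) l t).sum = l.sum + t.sum ∧
      (List.zipWith (· + ·) l t).length = l.length := by
  induction l generalizing t with
  | nil => cases t <;> simp_all
  | cons a l ih =>
    cases t with
    | nil => simp at h
    | cons c t =>
      obtain ⟨h1, h2, h3⟩ := ih (by simpa using h)
      refine ⟨?_, ?_, ?_⟩
      · simpa using h1
      · simp [h2]; omega
      · simp [h3]

theorem exists_zipWith_add {l l' : List ℕ} (h : List.Forall₂ (· ≤ ·) l l') :
    ∃ t : List ℕ, t.length = l.length ∧ l' = List.zipWith (· + ·) l t := by
  induction h with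
  | nil => exact ⟨[], rfl, rfl⟩
  | @cons a b l l' h _ ih =>
    obtain ⟨t, ht, rfl⟩ := ih
    exact ⟨(b - a) :: t, by simp [ht], by simp; omega⟩

theorem zipWith_add_injective {l t t' : List ℕ} (h : t.length = l.length) (h' : t'.length = l.length)
    (he : List.zipWith (· + ·) l t = List.zipWith (· + ·) l t') : t = t' := by
  induction l generalizing t t' with
  | nil => simp_all
  | cons a l ih =>
    cases t with
    | nil => simp at h
    | cons c t =>
      cases t' with
      | nil => simp at h'
      | cons c' t' =>
        simp only [List.zipWith_cons_cons, List.cons.injEq, Nat.add_left_cancel_iff] at he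
        rw [he.1, ih (by simpa using h) (by simpa using h') he.2]

theorem one_le_of_forall₂ {l l' : List ℕ} (h : List.Forall₂ (· ≤ ·) l l') (hl : ∀ x ∈ l, 1 ≤ x) :
    ∀ x ∈ l', 1 ≤ x := by
  induction h with
  | nil => simp
  | cons h _ ih =>
    simp only [List.mem_cons, forall_eq_or_imp] at *
    exact ⟨hl.1.trans h, ih hl.2⟩

/-! ### Counting words that contain a given word -/

/-- The number of words `B l'` of length `n` containing `B l`, with `l'` as long as `l`. -/
theorem ncard_B_same_length {l : List ℕ} (hl : ∀ x ∈ l, 1 ≤ x) (n : ℕ) :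
    {u : List Bool | u.length = n ∧ (∃ l', (∀ x ∈ l', 1 ≤ x) ∧ l'.length = l.length ∧ u = B l') ∧
      (B l).Sublist u}.ncard =
    {t : List ℕ | t.length = l.length ∧ l.sum + t.sum = n}.ncard := by
  symm
  refine Set.ncard_congr (fun t _ => B (List.zipWith (· + ·) l t)) ?_ ?_ ?_
  · rintro t ⟨h1, h2⟩
    obtain ⟨h3, h4, h5⟩ := zipWith_add_spec h1
    exact ⟨by rw [length_B, h4, h2], ⟨_, one_le_of_forall₂ h3 hl, h5, rfl⟩,
      wordFrom_sublist_wordFrom h3⟩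
  · rintro t t' ⟨h1, h2⟩ ⟨h1', h2'⟩ he
    obtain ⟨h3, h4, h5⟩ := zipWith_add_spec h1
    obtain ⟨h3', h4', h5'⟩ := zipWith_add_spec h1'
    exact zipWith_add_injective h1 h1' (wordFrom_injective (one_le_of_forall₂ h3 hl)
      (one_le_of_forall₂ h3' hl) (by rw [h5, h5']) he)
  · rintro u ⟨h1, ⟨l', h2, h3, rfl⟩, h4⟩
    obtain ⟨t, ht, rfl⟩ := exists_zipWith_add (forall₂_le_of_wordFrom_sublist hl h3.symm h4)
    refine ⟨t, ⟨ht, ?_⟩, rfl⟩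
    rw [length_B, (zipWith_add_spec ht).2.1] at h1
    exact h1

/-- The number of words of a given length containing a word depends only on its length. -/
theorem ncard_words_containing (n : ℕ) {w w' : List Bool} (h : w.length = w'.length) :
    {u : List Bool | u.length = n ∧ w.Sublist u}.ncard =
      {u : List Bool | u.length = n ∧ w'.Sublist u}.ncard := by
  -- Greedy matching: if the first letter of `u` is `b`, it consumes `b`; otherwise it is wasted.
  -- The recursion does not depend on which letter `b` is.
  have step : ∀ (n : ℕ) (b : Bool) (t : List Bool),
      {u : List Bool | u.length = n + 1 ∧ (b :: t).Sublist u}.ncard =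
        {u : List Bool | u.length = n ∧ t.Sublist u}.ncard +
        {u : List Bool | u.length = n ∧ (b :: t).Sublist u}.ncard := by
    intro n b t
    have e : {u : List Bool | u.length = n + 1 ∧ (b :: t).Sublist u} =
        List.cons b '' {u : List Bool | u.length = n ∧ t.Sublist u} ∪
        List.cons (!b) '' {u : List Bool | u.length = n ∧ (b :: t).Sublist u} := by
      ext u
      simp only [Set.mem_ofPred_eq, Set.mem_union, Set.mem_image]
      constructor
      · rintro ⟨h1, h2⟩
        cases u with
        | nil => simp at h1
        | cons c u =>
          by_cases hc : c = b
          · subst hc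
            exact Or.inl ⟨u, ⟨by simpa using h1, List.cons_sublist_cons.1 h2⟩, rfl⟩
          · have hc' : c = !b := by cases b <;> cases c <;> simp_all
            subst hc'
            refine Or.inr ⟨u, ⟨by simpa using h1, ?_⟩, rfl⟩
            exact cons_sublist_replicate_append (n := 1) (fun h => hc h.symm) h2
      · rintro (⟨u, ⟨h1, h2⟩, rfl⟩ | ⟨u, ⟨h1, h2⟩, rfl⟩)
        · exact ⟨by simpa using h1, List.cons_sublist_cons.2 h2⟩
        · exact ⟨by simpa using h1, h2.cons _⟩
    rw [e, Set.ncard_union_eq _ ((finite_words _ _).image _) ((finite_words _ _).image _),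
      Set.ncard_image_of_injective _ List.cons_injective,
      Set.ncard_image_of_injective _ List.cons_injective]
    rw [Set.disjoint_left]
    rintro _ ⟨u, -, rfl⟩ ⟨v, -, hv⟩
    simp at hv
  induction n generalizing w w' with
  | zero =>
    have e : ∀ w : List Bool, {u : List Bool | u.length = 0 ∧ w.Sublist u} =
        {u : List Bool | u = [] ∧ w.length = 0} := by
      intro w
      ext u
      simp only [Set.mem_ofPred_eq, List.length_eq_zero_iff]
      constructor
      · rintro ⟨rfl, h⟩
        simpa using h
      · rintro ⟨rfl, rfl⟩
        simp
    rw [e, e, h]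
  | succ n ih =>
    cases w with
    | nil =>
      cases w' with
      | nil => rfl
      | cons _ _ => simp at h
    | cons b t =>
      cases w' with
      | nil => simp at h
      | cons b' t' =>
        rw [step, step, ih h, ih (show t.length = t'.length by simpa using h)]

theorem ncard_zero_words_containing (n : ℕ) {t t' : List Bool} (h : t.length = t'.length) :
    {u : List Bool | u.length = n ∧ u.head? = some false ∧ (false :: t).Sublist u}.ncard =
      {u : List Bool | u.length = n ∧ u.head? = some false ∧ (false :: t').Sublist u}.ncard := by
  rcases n with _ | n
  · congr 1
    ext u
    simp only [Set.mem_ofPred_eq, List.length_eq_zero_iff]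
    constructor <;> rintro ⟨rfl, h, -⟩ <;> simp at h
  have e : ∀ t : List Bool, {u : List Bool | u.length = n + 1 ∧ u.head? = some false ∧
      (false :: t).Sublist u} = List.cons false '' {u : List Bool | u.length = n ∧ t.Sublist u} := by
    intro t
    ext u
    simp only [Set.mem_ofPred_eq, Set.mem_image]
    constructor
    · rintro ⟨h1, h2, h3⟩
      cases u with
      | nil => simp at h1
      | cons c u =>
        simp only [List.head?_cons, Option.some.injEq] at h2
        subst h2
        exact ⟨u, ⟨by simpa using h1, List.cons_sublist_cons.1 h3⟩, rfl⟩
    · rintro ⟨u, ⟨h1, h2⟩, rfl⟩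
      exact ⟨by simpa using h1, rfl, List.cons_sublist_cons.2 h2⟩
  rw [e, e, Set.ncard_image_of_injective _ List.cons_injective,
    Set.ncard_image_of_injective _ List.cons_injective, ncard_words_containing n h]

/-- `u` contains `w` or its complement. -/
def ContainsUpToNot (w u : List Bool) : Prop := w.Sublist u ∨ (w.map (!·)).Sublist u

theorem map_not_map_not (w : List Bool) : (w.map (!·)).map (!·) = w := by
  simp [Function.comp_def]

theorem map_not_injective : Function.Injective (List.map (!·) : List Bool → List Bool) :=
  Function.LeftInverse.injective map_not_map_not

theorem containsUpToNot_map_not_left {w u : List Bool} :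
    ContainsUpToNot (w.map (!·)) u ↔ ContainsUpToNot w u := by
  rw [ContainsUpToNot, map_not_map_not, or_comm, ContainsUpToNot]

theorem map_not_sublist_iff {w u : List Bool} :
    (w.map (!·)).Sublist (u.map (!·)) ↔ w.Sublist u :=
  ⟨fun h => by simpa only [map_not_map_not] using h.map (!·), fun h => h.map _⟩

theorem containsUpToNot_map_not_right {w u : List Bool} :
    ContainsUpToNot w (u.map (!·)) ↔ ContainsUpToNot w u := by
  conv_lhs => rw [← containsUpToNot_map_not_left]
  rw [ContainsUpToNot, map_not_sublist_iff, map_not_sublist_iff, ContainsUpToNot]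

theorem containsUpToNot_reverse {w u : List Bool} :
    ContainsUpToNot w.reverse u.reverse ↔ ContainsUpToNot w u := by
  rw [ContainsUpToNot, List.reverse_sublist, List.map_reverse, List.reverse_sublist,
    ContainsUpToNot]

/-- The number of words of length `n` starting with `0` and containing `w` or its complement. -/
noncomputable def count (w : List Bool) (n : ℕ) : ℕ :=
  {u : List Bool | u.length = n ∧ u.head? = some false ∧ ContainsUpToNot w u}.ncard

theorem count_map_not (w : List Bool) : count (w.map (!·)) = count w := by
  funext n
  simp only [count, containsUpToNot_map_not_left]

theorem count_eq_head_true (w : List Bool) (n : ℕ) : count w n =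
    {u : List Bool | u.length = n ∧ u.head? = some true ∧ ContainsUpToNot w u}.ncard := by
  rw [count, ← Set.ncard_image_of_injective _ map_not_injective]
  congr 1
  ext u
  simp only [Set.mem_image, Set.mem_ofPred_eq]
  constructor
  · rintro ⟨v, ⟨h1, h2, h3⟩, rfl⟩
    refine ⟨by simpa using h1, ?_, containsUpToNot_map_not_right.2 h3⟩
    rw [List.head?_map, h2]
    rfl
  · rintro ⟨h1, h2, h3⟩
    refine ⟨u.map (!·), ⟨by simpa using h1, ?_, containsUpToNot_map_not_right.2 h3⟩,
      map_not_map_not u⟩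
    rw [List.head?_map, h2]
    rfl

/-- Complementing is a bijection between words starting with 0 and words starting with 1. Reversal
does not respect first letters, and this form of the count removes them. -/
theorem two_mul_count {w : List Bool} (hw : w ≠ []) (n : ℕ) :
    2 * count w n = {u : List Bool | u.length = n ∧ ContainsUpToNot w u}.ncard := by
  have e : {u : List Bool | u.length = n ∧ ContainsUpToNot w u} =
      {u : List Bool | u.length = n ∧ u.head? = some false ∧ ContainsUpToNot w u} ∪
      {u : List Bool | u.length = n ∧ u.head? = some true ∧ ContainsUpToNot w u} := by
    ext u
    simp only [Set.mem_ofPred_eq, Set.mem_union]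
    constructor
    · rintro ⟨h1, h2⟩
      cases u with
      | nil => simp [ContainsUpToNot, hw] at h2
      | cons c u => cases c <;> simp [h2] at h1 ⊢ <;> exact h1
    · rintro (⟨h1, -, h2⟩ | ⟨h1, -, h2⟩) <;> exact ⟨h1, h2⟩
  rw [e, Set.ncard_union_eq _ (finite_words _ _) (finite_words _ _), ← count_eq_head_true, ← count,
    two_mul]
  rw [Set.disjoint_left]
  rintro u ⟨-, h, -⟩ ⟨-, h', -⟩
  rw [h] at h'
  simp at h'

theorem count_reverse {w : List Bool} (hw : w ≠ []) : count w.reverse = count w := by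
  funext n
  have h1 := two_mul_count hw n
  have h2 := two_mul_count (w := w.reverse) (by simpa using hw) n
  have h3 : {u : List Bool | u.length = n ∧ ContainsUpToNot w.reverse u}.ncard =
      {u : List Bool | u.length = n ∧ ContainsUpToNot w u}.ncard := by
    rw [← Set.ncard_image_of_injective _ List.reverse_injective]
    congr 1
    ext u
    simp only [Set.mem_image, Set.mem_ofPred_eq]
    constructor
    · rintro ⟨v, ⟨h4, h5⟩, rfl⟩
      refine ⟨by simpa using h4, ?_⟩
      rw [← containsUpToNot_reverse, List.reverse_reverse]
      exact h5
    · rintro ⟨h4, h5⟩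
      exact ⟨u.reverse, ⟨by simpa using h4, containsUpToNot_reverse.2 h5⟩, List.reverse_reverse u⟩
  omega

theorem count_zero (w : List Bool) : count w 0 = 0 := by
  rw [count, Set.ncard_eq_zero ((finite_words _ _))]
  ext u
  simp only [Set.mem_ofPred_eq, Set.mem_empty_iff_false, iff_false, List.length_eq_zero_iff]
  rintro ⟨rfl, h, -⟩
  simp at h

/-- The split is on the second letter of `u`. A second 0 is redundant: one 0 is enough before the 1
of the pattern, and the complement starts with 1 and skips it. If the second letter is 1, the first
0 of `u` matches that of the pattern and is useless for the complement, whose own first 1 is matched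
instead. -/
theorem count_cons_succ (v : List Bool) (n : ℕ) :
    count (false :: true :: v) (n + 1) =
      count (false :: true :: v) n + count (true :: v) n := by
  rw [count_eq_head_true (true :: v), count, count,
    ← Set.ncard_image_of_injective
      {u | u.length = n ∧ u.head? = some false ∧ ContainsUpToNot (false :: true :: v) u}
      (List.cons_injective (a := false)),
    ← Set.ncard_image_of_injective {u | _ ∧ u.head? = some true ∧ _}
      (List.cons_injective (a := false)),
    ← Set.ncard_union_eq _ ((finite_words _ _).image _) ((finite_words _ _).image _)]
  · congr 1
    ext u
    simp only [Set.mem_union, Set.mem_image, Set.mem_ofPred_eq]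
    have key : ∀ y : List Bool,
        (ContainsUpToNot (false :: true :: v) (false :: false :: y) ↔
          ContainsUpToNot (false :: true :: v) (false :: y)) ∧
        (ContainsUpToNot (false :: true :: v) (false :: true :: y) ↔
          ContainsUpToNot (true :: v) (true :: y)) := by
      intro y
      have a1 : ∀ (b : Bool) (x z : List Bool), ((!b) :: x).Sublist (b :: z) ↔
          ((!b) :: x).Sublist z := by
        intro b x z
        exact ⟨fun h => cons_sublist_replicate_append (n := 1) (by cases b <;> simp) h,
          fun h => h.cons _⟩
      have a2 := a1 false
      have a3 := a1 true
      simp only [Bool.not_false, Bool.not_true] at a2 a3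
      simp only [ContainsUpToNot, List.map_cons, List.cons_sublist_cons, Bool.not_false,
        Bool.not_true, a2, a3, and_self]
    constructor
    · rintro ⟨h1, h2, h3⟩
      match u, h2 with
      | [false], _ => simp [ContainsUpToNot] at h3
      | false :: false :: y, _ =>
        exact Or.inl ⟨false :: y, ⟨by simpa using h1, rfl, (key y).1.1 h3⟩, rfl⟩
      | false :: true :: y, _ =>
        exact Or.inr ⟨true :: y, ⟨by simpa using h1, rfl, (key y).2.1 h3⟩, rfl⟩
    · rintro (⟨u, ⟨h1, h2, h3⟩, rfl⟩ | ⟨u, ⟨h1, h2, h3⟩, rfl⟩)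
      · match u, h2 with
        | false :: y, _ => exact ⟨by simpa using h1, rfl, (key y).1.2 h3⟩
      · match u, h2 with
        | true :: y, _ => exact ⟨by simpa using h1, rfl, (key y).2.2 h3⟩
  · rw [Set.disjoint_left]
    rintro _ ⟨u, ⟨-, hu, -⟩, rfl⟩ ⟨v, ⟨-, hv, -⟩, h⟩
    rw [List.cons_injective h, hu] at hv
    simp at hv

/-- With value 0 at length 0, the recursion determines the count for `1 :: l` from the one for `l`.
-/
theorem count_B_cons_one {l l' : List ℕ} (h0 : l ≠ []) (hl : ∀ x ∈ l, 1 ≤ x) (h0' : l' ≠ [])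
    (hl' : ∀ x ∈ l', 1 ≤ x) (h : count (B l) = count (B l')) :
    count (B (1 :: l)) = count (B (1 :: l')) := by
  have key : ∀ l : List ℕ, l ≠ [] → (∀ x ∈ l, 1 ≤ x) → ∀ n, count (B (1 :: l)) (n + 1) =
      count (B (1 :: l)) n + count (B l) n := by
    intro l h0 hl n
    obtain ⟨x, hx⟩ := exists_B_eq_cons h0 hl
    have e1 : B (1 :: l) = false :: true :: x.map (!·) := by
      have : B (1 :: l) = false :: wordFrom (!false) l := rfl
      rw [this, ← map_not_wordFrom, ← B, hx]
      rfl
    have e2 : count (B l) = count (true :: x.map (!·)) := by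
      rw [← count_map_not, hx]
      rfl
    rw [e1, e2, count_cons_succ]
  funext n
  induction n with
  | zero => rw [count_zero, count_zero]
  | succ n ih => rw [key l h0 hl, key l' h0' hl', ih, h]

theorem count_B_reverse {l : List ℕ} (h0 : l ≠ []) (hl : ∀ x ∈ l, 1 ≤ x) :
    count (B l.reverse) = count (B l) := by
  obtain ⟨x, hx⟩ := exists_B_eq_cons h0 hl
  rw [← count_reverse (w := B l) (by simp [hx])]
  rw [B, B, reverse_wordFrom]
  cases not^[l.length + 1] false
  · rfl
  · rw [← count_map_not, map_not_wordFrom]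
    rfl

theorem count_B_ones_append {l l' : List ℕ} (s : ℕ) (h0 : l ≠ []) (hl : ∀ x ∈ l, 1 ≤ x)
    (h0' : l' ≠ []) (hl' : ∀ x ∈ l', 1 ≤ x) (h : count (B l) = count (B l')) :
    count (B (List.replicate s 1 ++ l)) = count (B (List.replicate s 1 ++ l')) := by
  induction s with
  | zero => exact h
  | succ s ih =>
    rw [List.replicate_succ, List.cons_append, List.cons_append]
    refine count_B_cons_one (by simp [h0]) ?_ (by simp [h0']) ?_ ih
    · intro x hx
      rcases List.mem_append.1 hx with hx | hx
      · exact (List.eq_of_mem_replicate hx).ge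
      · exact hl x hx
    · intro x hx
      rcases List.mem_append.1 hx with hx | hx
      · exact (List.eq_of_mem_replicate hx).ge
      · exact hl' x hx

/-- Parts equal to `1` can be moved from the front to the back. -/
theorem count_B_ones {l : List ℕ} (s r : ℕ) (h0 : l ≠ []) (hl : ∀ x ∈ l, 1 ≤ x) :
    count (B (List.replicate s 1 ++ l ++ List.replicate r 1)) =
      count (B (l ++ List.replicate (s + r) 1)) ∧
    count (B (List.replicate s 1 ++ l ++ List.replicate r 1)) =
      count (B (l.reverse ++ List.replicate (s + r) 1)) := by
  have pos : ∀ {l : List ℕ} (r : ℕ), (∀ x ∈ l, 1 ≤ x) → ∀ x ∈ l ++ List.replicate r 1, 1 ≤ x := by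
    intro l r hl x hx
    rcases List.mem_append.1 hx with hx | hx
    · exact hl x hx
    · exact (List.eq_of_mem_replicate hx).ge
  have hlr : ∀ x ∈ l.reverse, 1 ≤ x := fun x hx => hl x (by simpa using hx)
  have h0r : l.reverse ≠ [] := by simpa using h0
  have rev : ∀ l' : List ℕ, l' ≠ [] → (∀ x ∈ l', 1 ≤ x) → ∀ r,
      count (B (l' ++ List.replicate r 1)) = count (B (List.replicate r 1 ++ l'.reverse)) := by
    intro l' h0' hl' r
    rw [← count_B_reverse (by simp [h0']) (pos r hl'), List.reverse_append, List.reverse_replicate]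
  -- Behind the fixed prefix of `s` ones, reversing the remainder brings the `r` final ones to the
  -- front.
  have e1 : count (B (List.replicate s 1 ++ l ++ List.replicate r 1)) =
      count (B (List.replicate (s + r) 1 ++ l.reverse)) := by
    rw [List.append_assoc, List.replicate_add, List.append_assoc]
    refine count_B_ones_append s (by simp [h0]) (pos r hl) (by simp [h0]) ?_ (rev l h0 hl r)
    intro x hx
    rcases List.mem_append.1 hx with hx | hx
    · exact (List.eq_of_mem_replicate hx).ge
    · exact hlr x hx
  -- Behind all the ones, the remaining block can be reversed on its own.
  have e2 : count (B (List.replicate (s + r) 1 ++ l.reverse)) =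
      count (B (List.replicate (s + r) 1 ++ l)) :=
    count_B_ones_append _ h0r hlr h0 hl (count_B_reverse h0 hl)
  constructor
  · rw [e1, rev l h0 hl]
  · rw [e1, e2, rev _ h0r hlr, List.reverse_reverse]

/-- A word starting with `0` and containing the complement of an alternating word starting with
`0` contains this alternating word. -/
theorem containsUpToNot_ones_iff {u : List Bool} (k : ℕ) (hu : u.head? = some false) :
    ContainsUpToNot (B (List.replicate (k + 1) 1)) u ↔ (B (List.replicate (k + 1) 1)).Sublist u := by
  refine ⟨fun h => h.elim id fun h => ?_, Or.inl⟩
  rw [B, map_not_wordFrom] at h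
  have h1 : (wordFrom true (List.replicate k 1)).Sublist
      (wordFrom true (List.replicate (k + 1) 1)) :=
    wordFrom_ones_sublist (fun x hx => (List.eq_of_mem_replicate hx).ge) (by simp)
  match u, hu with
  | false :: y, _ =>
    rw [B, List.replicate_succ, wordFrom_cons_of_pos le_rfl]
    refine List.cons_sublist_cons.2 (h1.trans ?_)
    rw [List.replicate_succ, wordFrom_cons_of_pos le_rfl] at h ⊢
    exact cons_sublist_replicate_append (n := 1) (by simp) h

/-- The hypothesis matches the words starting with 1 with those ending in 0; the two sets compared
are their complements within the words satisfying `p`. -/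
theorem ncard_head_eq_ncard_getLast {n : ℕ} (p : List Bool → Prop)
    (hp : ∀ x : List Bool, x.length = n → (p (true :: x) ↔ p (x ++ [false]))) :
    {u : List Bool | u.length = n + 1 ∧ u.head? = some false ∧ p u}.ncard =
      {u : List Bool | u.length = n + 1 ∧ u.getLast? = some true ∧ p u}.ncard := by
  have e1 : {u : List Bool | u.length = n + 1 ∧ p u} =
      {u : List Bool | u.length = n + 1 ∧ u.head? = some false ∧ p u} ∪
      {u : List Bool | u.length = n + 1 ∧ u.head? = some true ∧ p u} := by
    ext u
    simp only [Set.mem_ofPred_eq, Set.mem_union, ← and_or_left, ← or_and_right]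
    refine and_congr_right fun h => (and_iff_right ?_).symm
    cases u with
    | nil => simp at h
    | cons c u => cases c <;> simp
  have e2 : {u : List Bool | u.length = n + 1 ∧ p u} =
      {u : List Bool | u.length = n + 1 ∧ u.getLast? = some true ∧ p u} ∪
      {u : List Bool | u.length = n + 1 ∧ u.getLast? = some false ∧ p u} := by
    ext u
    simp only [Set.mem_ofPred_eq, Set.mem_union, ← and_or_left, ← or_and_right]
    refine and_congr_right fun h => (and_iff_right ?_).symm
    rcases List.eq_nil_or_concat u with rfl | ⟨u, c, rfl⟩
    · simp at h
    · cases c <;> simp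
  have e3 : {u : List Bool | u.length = n + 1 ∧ u.head? = some true ∧ p u}.ncard =
      {u : List Bool | u.length = n + 1 ∧ u.getLast? = some false ∧ p u}.ncard := by
    refine Set.ncard_congr (fun u _ => u.tail ++ [false]) ?_ ?_ ?_
    · rintro u ⟨h1, h2, h3⟩
      match u, h2 with
      | true :: x, _ =>
        have hx : x.length = n := by simpa using h1
        exact ⟨by simp [hx], by simp, (hp x hx).1 h3⟩
    · rintro u v ⟨h1, h2, h3⟩ ⟨h1', h2', h3'⟩ h
      match u, h2, v, h2' with
      | true :: x, _, true :: y, _ =>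
        exact congrArg _ (List.append_cancel_right h)
    · rintro u ⟨h1, h2, h3⟩
      rcases List.eq_nil_or_concat u with rfl | ⟨x, c, rfl⟩
      · simp at h1
      · have hx : x.length = n := by simpa using h1
        have hc : c = false := by simpa using h2
        subst hc
        rw [List.concat_eq_append] at h3 ⊢
        exact ⟨true :: x, ⟨by simp [hx], rfl, (hp x hx).2 h3⟩, rfl⟩
  have d1 : Disjoint {u : List Bool | u.length = n + 1 ∧ u.head? = some false ∧ p u}
      {u : List Bool | u.length = n + 1 ∧ u.head? = some true ∧ p u} := by
    rw [Set.disjoint_left]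
    rintro u ⟨-, h, -⟩ ⟨-, h', -⟩
    rw [h] at h'
    simp at h'
  have d2 : Disjoint {u : List Bool | u.length = n + 1 ∧ u.getLast? = some true ∧ p u}
      {u : List Bool | u.length = n + 1 ∧ u.getLast? = some false ∧ p u} := by
    rw [Set.disjoint_left]
    rintro u ⟨-, h, -⟩ ⟨-, h', -⟩
    rw [h] at h'
    simp at h'
  have h1 := congrArg Set.ncard e1
  have h2 := congrArg Set.ncard e2
  rw [Set.ncard_union_eq d1 (finite_words _ _) (finite_words _ _)] at h1
  rw [Set.ncard_union_eq d2 (finite_words _ _) (finite_words _ _)] at h2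
  omega

/-! ### From circular permutations to words -/

/-- The circular permutations of size `n` avoiding `[1432]` and containing `P`. -/
def containers {m : ℕ} (n : ℕ) (P : CircPerm m) : Set (CircPerm n) :=
  {C | ¬ Contains C (circ perm1432) ∧ Contains C P}

theorem finite_circPerm (n : ℕ) : Finite (CircPerm n) := Quotient.finite _

theorem wilfEquiv_of_ncard_containers {m m' : ℕ} {P : CircPerm m} {Q : CircPerm m'}
    (h : ∀ n, (containers (n + 1) P).ncard = (containers (n + 1) Q).ncard) :
    WilfEquiv (pair1432 P) (pair1432 Q) := by
  intro n hn
  obtain ⟨n, rfl⟩ : ∃ n', n = n' + 1 := ⟨n - 1, by omega⟩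
  have := finite_circPerm (n + 1)
  have key : ∀ {m : ℕ} (P : CircPerm m), (Av (n + 1) (pair1432 P)).ncard +
      (containers (n + 1) P).ncard =
      {C : CircPerm (n + 1) | ¬ Contains C (circ perm1432)}.ncard := by
    intro m P
    rw [← Set.ncard_union_eq _ (Set.toFinite _) (Set.toFinite _)]
    · congr 1
      ext C
      simp only [Av, pair1432, containers, Set.mem_union, Set.mem_ofPred_eq,
        Set.mem_insert_iff, Set.mem_singleton_iff, forall_eq_or_imp, forall_eq]
      tauto
    · rw [Set.disjoint_left]
      rintro C h1 ⟨-, h2⟩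
      exact h1 ⟨_, P⟩ (by simp [pair1432]) h2
  have h1 := key P
  have h2 := key Q
  have h3 := h n
  omega

theorem alternating_sublist_B {l : List ℕ} (hl : ∀ x ∈ l, 1 ≤ x) (h : 5 ≤ l.length) :
    [false, true, false, true, false].Sublist (B l) :=
  wordFrom_ones_sublist (j := 5) hl h

theorem five_le_length {l : List ℕ} (h : [false, true, false, true, false].Sublist (B l)) :
    5 ≤ l.length :=
  le_length_of_wordFrom_ones_sublist (j := 5) h

theorem three_runs_sublist_B {l : List ℕ} (hl : ∀ x ∈ l, 1 ≤ x) (h : 3 ≤ l.length) :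
    [false, true, false].Sublist (B l) :=
  wordFrom_ones_sublist (j := 3) hl h

theorem three_runs_sublist_of_alternating {u : List Bool}
    (h : [false, true, false, true, false].Sublist u) : [false, true, false].Sublist u :=
  List.Sublist.trans (by decide) h

theorem exists_gw_inv_eq_gw {n : ℕ} {u : List Bool} (hu : u.length = n + 1)
    (h0 : u.head? = some false) (h : ¬ [false, true, false, true, false].Sublist u) :
    ∃ x : List Bool, x.length = n ∧ circ (gw (n + 1) u)⁻¹ = circ (gw (n + 1) (false :: x)) := by
  obtain ⟨a, b, c, d, rfl⟩ : ∃ a b c d, u = List.replicate a false ++ (List.replicate b true ++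
      (List.replicate c false ++ List.replicate d true)) := by
    match u, h0 with
    | false :: y, _ =>
      obtain ⟨l, -, hl, hy⟩ := exists_eq_B y
      rw [hy] at h ⊢
      have h5 : ¬ 5 ≤ l.length := fun h5 => h (alternating_sublist_B hl h5)
      match l, h5 with
      | [], _ => exact ⟨0, 0, 0, 0, by simp [B, wordFrom]⟩
      | [a], _ => exact ⟨a, 0, 0, 0, by simp [B, wordFrom]⟩
      | [a, b], _ => exact ⟨a, b, 0, 0, by simp [B, wordFrom]⟩
      | [a, b, c], _ => exact ⟨a, b, c, 0, by simp [B, wordFrom]⟩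
      | [a, b, c, d], _ => exact ⟨a, b, c, d, by simp [B, wordFrom]⟩
      | _ :: _ :: _ :: _ :: _ :: _, h5 => simp at h5
  have hs : a + b + c + d = n + 1 := by
    simp at hu
    omega
  rw [gw_inv_four_runs _ _ _ _ hs]
  exact exists_circ_gw_eq (by simp; omega)

theorem contains_gw_gw_iff {n k : ℕ} {u x : List Bool} (hu : u.length = n) (hx : x.length = k)
    (h : [false, true, false].Sublist (false :: x)) :
    Contains (circ (gw n u)) (circ (gw (k + 1) (false :: x))) ↔ ContainsUpToNot (false :: x) u := by
  rw [contains_circ_gw_iff hu]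
  constructor
  · rintro ⟨v, hv, hvu, he⟩
    rcases (circ_gw_eq_iff hv hx h).1 he with rfl | rfl
    · exact Or.inl hvu
    · exact Or.inr hvu
  · rintro (h1 | h1)
    · exact ⟨_, by simpa using hx, h1, rfl⟩
    · exact ⟨_, by simpa using hx, h1, circ_gw_map_not (by simpa using hx)⟩

theorem contains_gw_inv_gw_inv_iff {n k m : ℕ} {u N : List Bool} (hu : u.length = n)
    (hN : N.length + m = k + 1)
    (h : [false, true, false].Sublist (N ++ List.replicate m false))
    (hf : N.head? = some false) (hl : N.getLast? = some true) :
    Contains (circ (gw n u)⁻¹) (circ (gw (k + 1) (N ++ List.replicate m false))⁻¹) ↔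
      ∃ i j, i + j = m ∧
        (List.replicate i true ++ (N ++ List.replicate j false)).Sublist u := by
  rw [contains_circ_gw_inv_iff hu]
  constructor
  · rintro ⟨v, hv, hvu, he⟩
    obtain ⟨i, j, hij, rfl⟩ := (circ_gw_inv_eq_iff hv hN h hf hl).1 he
    exact ⟨i, j, hij, hvu⟩
  · rintro ⟨i, j, hij, hs⟩
    have hv : (List.replicate i true ++ (N ++ List.replicate j false)).length = k + 1 := by
      simp
      omega
    exact ⟨_, hv, hs, (circ_gw_inv_eq_iff hv hN h hf hl).2 ⟨i, j, hij, rfl⟩⟩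

theorem circ_gw_injOn {n : ℕ} {u v : List Bool} (hu : u.length = n + 1) (hv : v.length = n + 1)
    (hu0 : u.head? = some false) (hv0 : v.head? = some false)
    (h : [false, true, false].Sublist v) (he : circ (gw (n + 1) u) = circ (gw (n + 1) v)) :
    u = v := by
  match u, hu0, v, hv0 with
  | false :: x, _, false :: y, _ =>
    exact gw_injective hu hv h (eq_of_circ_eq_of_last he (gw_last _) (gw_last _))

theorem circ_gw_inv_injOn {n : ℕ} {u v : List Bool} (hu : u.length = n + 1)
    (hv : v.length = n + 1) (hu0 : u.head? = some false) (hv0 : v.head? = some false)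
    (h : [false, true, false].Sublist v) (he : circ (gw (n + 1) u)⁻¹ = circ (gw (n + 1) v)⁻¹) :
    u = v := by
  match u, hu0, v, hv0 with
  | false :: x, _, false :: y, _ =>
    exact gw_injective hu hv h
      (inv_injective (eq_of_circ_eq_of_last he (gw_inv_last _) (gw_inv_last _)))

/-- Ensures that the words being counted have enough runs to be recovered from their circular
permutations. In a word starting with 0, a later 101 supplies 10 after that 0. -/
theorem three_runs_sublist_of_containsUpToNot {w u : List Bool} (hu : u.head? = some false)
    (h : [false, true, false].Sublist w) (hwu : ContainsUpToNot w u) :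
    [false, true, false].Sublist u := by
  rcases hwu with h1 | h1
  · exact h.trans h1
  · have h2 : [true, false, true].Sublist u := (h.map (!·)).trans h1
    match u, hu with
    | false :: y, _ =>
      have h3 : [true, false, true].Sublist y :=
        cons_sublist_replicate_append (n := 1) (by simp) h2
      exact List.cons_sublist_cons.2 (List.Sublist.trans (by decide) h3)

/-- Each avoider of [1432] is counted once: as G(u) whenever possible, otherwise as IG(u), which
then needs at least five runs. The two kinds are disjoint by `circ_gw_inv_ne_circ_gw`. -/
theorem ncard_containers_gw (n : ℕ) {k : ℕ} {x : List Bool} (hx : x.length = k)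
    (h : [false, true, false].Sublist (false :: x)) :
    (containers (n + 1) (circ (gw (k + 1) (false :: x)))).ncard = count (false :: x) (n + 1) +
      {u : List Bool | u.length = n + 1 ∧ u.head? = some false ∧
        [false, true, false, true, false].Sublist u ∧
        Contains (circ (gw (n + 1) u)⁻¹) (circ (gw (k + 1) (false :: x)))}.ncard := by
  have e : containers (n + 1) (circ (gw (k + 1) (false :: x))) =
      (fun u => circ (gw (n + 1) u)) '' {u : List Bool | u.length = n + 1 ∧
        u.head? = some false ∧ ContainsUpToNot (false :: x) u} ∪
      (fun u => circ (gw (n + 1) u)⁻¹) '' {u : List Bool | u.length = n + 1 ∧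
        u.head? = some false ∧ [false, true, false, true, false].Sublist u ∧
        Contains (circ (gw (n + 1) u)⁻¹) (circ (gw (k + 1) (false :: x)))} := by
    ext C
    simp only [containers, Set.mem_union, Set.mem_image, Set.mem_ofPred_eq]
    constructor
    · rintro ⟨h1, h2⟩
      obtain ⟨σ, rfl⟩ := QuotientGroup.mk_surjective C
      have hG : ∀ y : List Bool, y.length = n → circ σ = circ (gw (n + 1) (false :: y)) →
          ∃ u : List Bool, (u.length = n + 1 ∧ u.head? = some false ∧
            ContainsUpToNot (false :: x) u) ∧ circ (gw (n + 1) u) = circ σ := by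
        intro y hy h3
        have h2' : Contains (circ σ) (circ (gw (k + 1) (false :: x))) := h2
        rw [h3, contains_gw_gw_iff (by simpa using hy) hx h] at h2'
        exact ⟨_, ⟨by simpa using hy, rfl, h2'⟩, h3.symm⟩
      obtain ⟨y, hy, h3 | h3⟩ := exists_word_of_not_contains_perm1432 σ h1
      · exact Or.inl (hG y hy h3)
      · by_cases h5 : [false, true, false, true, false].Sublist (false :: y)
        · right
          refine ⟨_, ⟨by simpa using hy, rfl, h5, ?_⟩, h3.symm⟩
          rw [← h3]
          exact h2
        · left
          obtain ⟨z, hz, h4⟩ := exists_gw_inv_eq_gw (n := n) (by simpa using hy) rfl h5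
          exact hG z hz (h3.trans h4)
    · rintro (⟨u, ⟨h1, h2, h3⟩, rfl⟩ | ⟨u, ⟨h1, h2, h3, h4⟩, rfl⟩)
      · exact ⟨not_contains_gw_perm1432 h1, (contains_gw_gw_iff h1 hx h).2 h3⟩
      · exact ⟨not_contains_gw_inv_perm1432 h1, h4⟩
  have := finite_circPerm (n + 1)
  rw [e, Set.ncard_union_eq _ (Set.toFinite _) (Set.toFinite _), Set.InjOn.ncard_image,
    Set.InjOn.ncard_image, count]
  · rintro u ⟨h1, h2, h3, -⟩ v ⟨h1', h2', h3', -⟩ he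
    exact circ_gw_inv_injOn h1 h1' h2 h2' (three_runs_sublist_of_alternating h3') he
  · rintro u ⟨h1, h2, h3⟩ v ⟨h1', h2', h3'⟩ he
    exact circ_gw_injOn h1 h1' h2 h2' (three_runs_sublist_of_containsUpToNot h2' h h3') he
  · rw [Set.disjoint_left]
    rintro _ ⟨u, ⟨h1, -⟩, rfl⟩ ⟨v, ⟨h1', -, h3, -⟩, he⟩
    exact circ_gw_inv_ne_circ_gw h1 h1' h3 he

/-- A pattern IG(w) with five runs is no G(v), so only members of the IG family can contain it. -/
theorem ncard_containers_gw_inv (n : ℕ) {k : ℕ} {w : List Bool} (hw : w.length = k)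
    (h : [false, true, false, true, false].Sublist w) :
    (containers (n + 1) (circ (gw k w)⁻¹)).ncard =
      {u : List Bool | u.length = n + 1 ∧ u.head? = some false ∧
        Contains (circ (gw (n + 1) u)⁻¹) (circ (gw k w)⁻¹)}.ncard := by
  have hne : ∀ y : List Bool, y.length = n + 1 →
      ¬ Contains (circ (gw (n + 1) y)) (circ (gw k w)⁻¹) := by
    intro y hy hc
    rw [contains_circ_gw_iff hy] at hc
    obtain ⟨v, hv, -, he⟩ := hc
    exact circ_gw_inv_ne_circ_gw hv hw h he.symm
  have h5 : ∀ u : List Bool, u.length = n + 1 → u.head? = some false →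
      Contains (circ (gw (n + 1) u)⁻¹) (circ (gw k w)⁻¹) →
      [false, true, false, true, false].Sublist u := by
    intro u h1 h2 h3
    by_contra hc
    obtain ⟨z, hz, h4⟩ := exists_gw_inv_eq_gw h1 h2 hc
    rw [h4] at h3
    exact hne _ (by simpa using hz) h3
  have e : containers (n + 1) (circ (gw k w)⁻¹) =
      (fun u => circ (gw (n + 1) u)⁻¹) '' {u : List Bool | u.length = n + 1 ∧
        u.head? = some false ∧ Contains (circ (gw (n + 1) u)⁻¹) (circ (gw k w)⁻¹)} := by
    ext C
    simp only [containers, Set.mem_image, Set.mem_ofPred_eq]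
    constructor
    · rintro ⟨h1, h2⟩
      obtain ⟨σ, rfl⟩ := QuotientGroup.mk_surjective C
      have h2' : Contains (circ σ) (circ (gw k w)⁻¹) := h2
      obtain ⟨y, hy, h3 | h3⟩ := exists_word_of_not_contains_perm1432 σ h1
      · rw [h3] at h2'
        exact absurd h2' (hne _ (by simpa using hy))
      · rw [h3] at h2'
        exact ⟨_, ⟨by simpa using hy, rfl, h2'⟩, h3.symm⟩
    · rintro ⟨u, ⟨h1, h2, h3⟩, rfl⟩
      exact ⟨not_contains_gw_inv_perm1432 h1, h3⟩
  rw [e, Set.InjOn.ncard_image]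
  rintro u ⟨h1, h2, h3⟩ v ⟨h1', h2', h3'⟩ he
  exact circ_gw_inv_injOn h1 h1' h2 h2' (three_runs_sublist_of_alternating (h5 v h1' h2' h3')) he

theorem head?_B {l : List ℕ} (h0 : l ≠ []) (hl : ∀ x ∈ l, 1 ≤ x) : (B l).head? = some false := by
  obtain ⟨x, hx⟩ := exists_B_eq_cons h0 hl
  simp [hx]

theorem reverse_map_not_B {l : List ℕ} (he : Even l.length) :
    (B l).reverse.map (!·) = B l.reverse := by
  rw [B, reverse_wordFrom, map_not_wordFrom, Function.iterate_succ_apply, not_iterate_even he]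
  rfl

theorem getLast?_B {l : List ℕ} (h0 : l ≠ []) (hl : ∀ x ∈ l, 1 ≤ x) (he : Even l.length) :
    (B l).getLast? = some true := by
  have h1 := reverse_map_not_B he
  have h2 := head?_B (l := l.reverse) (by simpa using h0) (by simpa using hl)
  rw [← h1, List.head?_map, List.head?_reverse] at h2
  cases h : (B l).getLast? with
  | none => simp [h] at h2
  | some b => cases b <;> simp [h] at h2 ⊢

/-- The count of the words with at least five runs that contain a given word with four runs. -/
theorem ncard_five_runs_containing {l l' : List ℕ} (hl : ∀ x ∈ l, 1 ≤ x) (hl' : ∀ x ∈ l', 1 ≤ x)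
    (h4 : l.length = 4) (h4' : l'.length = 4) (hs : l.sum = l'.sum) (n : ℕ) :
    {u : List Bool | u.length = n ∧ u.head? = some false ∧
      [false, true, false, true, false].Sublist u ∧ (B l).Sublist u}.ncard =
    {u : List Bool | u.length = n ∧ u.head? = some false ∧
      [false, true, false, true, false].Sublist u ∧ (B l').Sublist u}.ncard := by
  -- A word starting with 0 and containing `B l` has at least four runs. Those with exactly four are
  -- counted by the excesses of the run sizes, and both they and the total depend only on `l.sum`.
  have key : ∀ l : List ℕ, (∀ x ∈ l, 1 ≤ x) → l.length = 4 →
      {u : List Bool | u.length = n ∧ u.head? = some false ∧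
        [false, true, false, true, false].Sublist u ∧ (B l).Sublist u}.ncard +
      {t : List ℕ | t.length = 4 ∧ l.sum + t.sum = n}.ncard =
      {u : List Bool | u.length = n ∧ u.head? = some false ∧ (B l).Sublist u}.ncard := by
    intro l hl h4
    rw [← h4, ← ncard_B_same_length hl, ← Set.ncard_union_eq _ (finite_words _ _)
      (finite_words _ _)]
    · congr 1
      ext u
      simp only [Set.mem_union, Set.mem_ofPred_eq]
      constructor
      · rintro (⟨h1, h2, -, h3⟩ | ⟨h1, ⟨l', h2, h3, rfl⟩, h5⟩)
        · exact ⟨h1, h2, h3⟩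
        · refine ⟨h1, head?_B ?_ h2, h5⟩
          rintro rfl
          simp at h3
          omega
      · rintro ⟨h1, h2, h3⟩
        by_cases h5 : [false, true, false, true, false].Sublist u
        · exact Or.inl ⟨h1, h2, h5, h3⟩
        · right
          refine ⟨h1, ?_, h3⟩
          match u, h2 with
          | false :: y, _ =>
            obtain ⟨l', h0', hl', hy⟩ := exists_eq_B y
            refine ⟨l', hl', ?_, hy⟩
            rw [hy] at h5 h3
            have h6 : ¬ 5 ≤ l'.length := fun h6 => h5 (alternating_sublist_B hl' h6)
            have h7 : 4 ≤ l'.length := le_length_of_wordFrom_ones_sublist (b := false)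
              ((wordFrom_ones_sublist hl h4.ge).trans h3)
            omega
    · rw [Set.disjoint_left]
      rintro u ⟨-, -, h1, -⟩ ⟨-, ⟨l', -, h2, rfl⟩, -⟩
      have := five_le_length h1
      omega
  have h1 := key l hl h4
  have h2 := key l' hl' h4'
  have h3 : {u : List Bool | u.length = n ∧ u.head? = some false ∧ (B l).Sublist u}.ncard =
      {u : List Bool | u.length = n ∧ u.head? = some false ∧ (B l').Sublist u}.ncard := by
    obtain ⟨x, hx⟩ := exists_B_eq_cons (l := l) (by rintro rfl; simp at h4) hl
    obtain ⟨x', hx'⟩ := exists_B_eq_cons (l := l') (by rintro rfl; simp at h4') hl'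
    have e := length_B l
    have e' := length_B l'
    rw [hx] at e ⊢
    rw [hx'] at e' ⊢
    simp only [List.length_cons] at e e'
    exact ncard_zero_words_containing n (by omega)
  rw [hs] at h1
  omega

theorem B_four (a b c d : ℕ) : B [a, b, c, d] = List.replicate a false ++ (List.replicate b true ++
    (List.replicate c false ++ List.replicate d true)) := by
  simp [B, wordFrom]

theorem B_three (a b c : ℕ) : B [a, b, c] = List.replicate a false ++ (List.replicate b true ++
    (List.replicate c false ++ List.replicate 0 true)) := by
  simp [B, wordFrom]

/-! ### The Wilf equivalences -/

/-- The hypothesis settles the G family. The IG family contributes nothing from five runs on, and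
for four runs its contribution depends only on the size. -/
theorem wilfEquiv_gw {k : ℕ} {l l' : List ℕ} (hl : ∀ x ∈ l, 1 ≤ x) (hl' : ∀ x ∈ l', 1 ≤ x)
    (h4 : 4 ≤ l.length) (he : l.length = l'.length) (hs : l.sum = k + 1) (hs' : l'.sum = k + 1)
    (h : count (B l) = count (B l')) :
    WilfEquiv (pair1432 (circ (gw (k + 1) (B l)))) (pair1432 (circ (gw (k + 1) (B l')))) := by
  apply wilfEquiv_of_ncard_containers
  intro n
  have e : ∀ l : List ℕ, (∀ x ∈ l, 1 ≤ x) → 4 ≤ l.length → l.sum = k + 1 →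
      (containers (n + 1) (circ (gw (k + 1) (B l)))).ncard = count (B l) (n + 1) +
      {u : List Bool | u.length = n + 1 ∧ u.head? = some false ∧
        [false, true, false, true, false].Sublist u ∧
        Contains (circ (gw (n + 1) u)⁻¹) (circ (gw (k + 1) (B l)))}.ncard := by
    intro l hl h4 hs
    obtain ⟨x, hx⟩ := exists_B_eq_cons (l := l) (by rintro rfl; simp at h4) hl
    have h3 := three_runs_sublist_B hl (by omega)
    have h5 := length_B l
    rw [hx] at h3 h5 ⊢
    exact ncard_containers_gw n (by simp at h5; omega) h3
  rw [e l hl h4 hs, e l' hl' (he ▸ h4) hs', h]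
  congr 1
  by_cases h5 : 5 ≤ l.length
  · have e2 : ∀ l : List ℕ, (∀ x ∈ l, 1 ≤ x) → 5 ≤ l.length → l.sum = k + 1 →
      {u : List Bool | u.length = n + 1 ∧ u.head? = some false ∧
        [false, true, false, true, false].Sublist u ∧
        Contains (circ (gw (n + 1) u)⁻¹) (circ (gw (k + 1) (B l)))} = ∅ := by
      intro l hl h5 hs
      ext u
      simp only [Set.mem_ofPred_eq, Set.mem_empty_iff_false, iff_false]
      rintro ⟨h1, -, -, h2⟩
      rw [contains_circ_gw_inv_iff h1] at h2
      obtain ⟨v, hv, -, he⟩ := h2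
      exact circ_gw_ne_circ_gw_inv hv (by rw [length_B, hs]) (alternating_sublist_B hl h5) he.symm
    rw [e2 l hl h5 hs, e2 l' hl' (he ▸ h5) hs']
  -- With four runs, exchanging the two middle sizes rewrites G as IG; the word ends in 1, so its IG
  -- class contains no other word.
  · have e3 : ∀ l : List ℕ, (∀ x ∈ l, 1 ≤ x) → l.length = 4 → l.sum = k + 1 →
      ∃ l' : List ℕ, (∀ x ∈ l', 1 ≤ x) ∧ l'.length = 4 ∧ l'.sum = k + 1 ∧ ∀ u : List Bool,
        u.length = n + 1 → (Contains (circ (gw (n + 1) u)⁻¹) (circ (gw (k + 1) (B l))) ↔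
          (B l').Sublist u) := by
      intro l hl h4 hs
      match l, h4 with
      | [a, b, c, d], _ =>
        have hp : ∀ x ∈ [a, c, b, d], 1 ≤ x := by
          intro x hx
          apply hl
          simp only [List.mem_cons, List.not_mem_nil, or_false] at hx ⊢
          tauto
        have hs' : [a, c, b, d].sum = k + 1 := by simp at hs ⊢; omega
        refine ⟨[a, c, b, d], hp, rfl, hs', fun u hu => ?_⟩
        have h1 : gw (k + 1) (B [a, b, c, d]) =
            (gw (k + 1) (B [a, c, b, d] ++ List.replicate 0 false))⁻¹ := by
          rw [List.replicate_zero, List.append_nil, B_four, B_four, gw_inv_four_runs]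
          simp at hs
          omega
        rw [h1, contains_gw_inv_gw_inv_iff hu (by rw [length_B, hs'])
          (by simpa using three_runs_sublist_B hp (by simp)) (head?_B (by simp) hp)
          (getLast?_B (by simp) hp ⟨2, rfl⟩)]
        constructor
        · rintro ⟨i, j, hij, h2⟩
          obtain ⟨rfl, rfl⟩ : i = 0 ∧ j = 0 := by omega
          simpa using h2
        · intro h2
          exact ⟨0, 0, rfl, by simpa using h2⟩
    obtain ⟨m, hm, hm4, hms, hmu⟩ := e3 l hl (by omega) hs
    obtain ⟨m', hm', hm4', hms', hmu'⟩ := e3 l' hl' (by omega) hs'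
    have e4 : ∀ (l m : List ℕ), (∀ u : List Bool, u.length = n + 1 →
        (Contains (circ (gw (n + 1) u)⁻¹) (circ (gw (k + 1) (B l))) ↔ (B m).Sublist u)) →
        {u : List Bool | u.length = n + 1 ∧ u.head? = some false ∧
          [false, true, false, true, false].Sublist u ∧
          Contains (circ (gw (n + 1) u)⁻¹) (circ (gw (k + 1) (B l)))} =
        {u : List Bool | u.length = n + 1 ∧ u.head? = some false ∧
          [false, true, false, true, false].Sublist u ∧ (B m).Sublist u} := by
      intro l m h
      ext u
      simp only [Set.mem_ofPred_eq]
      exact and_congr_right fun h1 => by rw [h u h1]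
    rw [e4 l m hmu, e4 l' m' hmu',
      ncard_five_runs_containing hm hm' hm4 hm4' (by rw [hms, hms'])]

theorem ncard_containers_gw_alternating (n : ℕ) {k : ℕ} (hk : 5 ≤ k + 1) :
    (containers (n + 1) (circ (gw (k + 1) (B (List.replicate (k + 1) 1))))).ncard =
      {u : List Bool | u.length = n + 1 ∧ u.head? = some false ∧
        (B (List.replicate (k + 1) 1)).Sublist u}.ncard := by
  have hl : ∀ x ∈ List.replicate (k + 1) 1, 1 ≤ x := fun x hx => (List.eq_of_mem_replicate hx).ge
  have h5 := alternating_sublist_B hl (by simpa using hk)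
  obtain ⟨x, hx⟩ := exists_B_eq_cons (l := List.replicate (k + 1) 1) (by simp) hl
  have h6 := length_B (List.replicate (k + 1) 1)
  simp only [List.sum_replicate, smul_eq_mul, mul_one] at h6
  have e1 : {u : List Bool | u.length = n + 1 ∧ u.head? = some false ∧
        (B (List.replicate (k + 1) 1)).Sublist u} = {u : List Bool | u.length = n + 1 ∧
          u.head? = some false ∧ ContainsUpToNot (B (List.replicate (k + 1) 1)) u} := by
    ext u
    simp only [Set.mem_ofPred_eq]
    exact and_congr_right fun _ => and_congr_right fun h => (containsUpToNot_ones_iff k h).symm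
  rw [e1, ← count]
  rw [hx] at h5 h6 ⊢
  rw [ncard_containers_gw n (by simpa using h6) (three_runs_sublist_of_alternating h5)]
  convert Nat.add_zero _ using 2
  rw [Set.ncard_eq_zero (finite_words _ _)]
  ext u
  simp only [Set.mem_ofPred_eq, Set.mem_empty_iff_false, iff_false]
  rintro ⟨h1, -, -, h2⟩
  rw [contains_circ_gw_inv_iff h1] at h2
  obtain ⟨v, hv, -, he⟩ := h2
  exact circ_gw_ne_circ_gw_inv hv h6 h5 he.symm

/-- The word ends in 1, so there are no final zeros to shift and containment means having `B l` as a
subword. The number of words starting with 0 that do so depends only on the length of `B l`. The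
alternating word yields the same number under G, since there the complement is redundant. -/
theorem wilfEquiv_gw_inv_even {k : ℕ} {l : List ℕ} (hl : ∀ x ∈ l, 1 ≤ x) (h5 : 5 ≤ l.length)
    (he : Even l.length) (hs : l.sum = k + 1) :
    WilfEquiv (pair1432 (circ (gw (k + 1) (B l))⁻¹))
      (pair1432 (circ (gw (k + 1) (B (List.replicate (k + 1) 1))))) := by
  have h0 : l ≠ [] := by
    rintro rfl
    simp at h5
  have hk : l.length ≤ k + 1 := by
    have := (wordFrom_ones_sublist (b := false) hl le_rfl).length_le
    rw [length_wordFrom, length_wordFrom, hs] at this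
    simpa using this
  apply wilfEquiv_of_ncard_containers
  intro n
  rw [ncard_containers_gw_inv n (by rw [length_B, hs]) (alternating_sublist_B hl h5),
    ncard_containers_gw_alternating n (by omega)]
  have e : {u : List Bool | u.length = n + 1 ∧ u.head? = some false ∧
      Contains (circ (gw (n + 1) u)⁻¹) (circ (gw (k + 1) (B l))⁻¹)} =
      {u : List Bool | u.length = n + 1 ∧ u.head? = some false ∧ (B l).Sublist u} := by
    ext u
    simp only [Set.mem_ofPred_eq]
    refine and_congr_right fun h1 => and_congr_right fun _ => ?_
    have h2 : B l = B l ++ List.replicate 0 false := by simp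
    rw [h2, contains_gw_inv_gw_inv_iff h1 (by rw [length_B, hs])
      (by simpa using three_runs_sublist_B hl (by omega)) (head?_B h0 hl) (getLast?_B h0 hl he)]
    constructor
    · rintro ⟨i, j, hij, h2⟩
      obtain ⟨rfl, rfl⟩ : i = 0 ∧ j = 0 := by omega
      simpa using h2
    · intro h2
      exact ⟨0, 0, rfl, by simpa using h2⟩
  rw [e]
  obtain ⟨x, hx⟩ := exists_B_eq_cons h0 hl
  obtain ⟨x', hx'⟩ := exists_B_eq_cons (l := List.replicate (k + 1) 1) (by simp)
    (fun x hx => (List.eq_of_mem_replicate hx).ge)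
  have e1 := length_B l
  have e2 := length_B (List.replicate (k + 1) 1)
  simp only [List.sum_replicate, smul_eq_mul, mul_one] at e2
  rw [hx] at e1 ⊢
  rw [hx'] at e2 ⊢
  simp only [List.length_cons] at e1 e2
  exact ncard_zero_words_containing _ (by omega)

theorem contains_gw_inv_B_iff {n k m : ℕ} {l : List ℕ} {u : List Bool} (hu : u.length = n)
    (hl : ∀ x ∈ l, 1 ≤ x) (h4 : 4 ≤ l.length) (he : Even l.length) (hs : l.sum + m = k + 1) :
    Contains (circ (gw n u)⁻¹) (circ (gw (k + 1) (B (l ++ [m])))⁻¹) ↔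
      ∃ i j, i + j = m ∧
        (List.replicate i true ++ (B l ++ List.replicate j false)).Sublist u := by
  have h0 : l ≠ [] := by
    rintro rfl
    simp at h4
  rw [B_append_of_even he]
  exact contains_gw_inv_gw_inv_iff hu (by rw [length_B, hs])
    ((three_runs_sublist_B hl (by omega)).trans (List.sublist_append_left _ _))
    (head?_B h0 hl) (getLast?_B h0 hl he)

/-- A single final 0 can be shifted, which turns the odd alternating word into its complement. The
IG condition on a word is therefore the same as the G condition. -/
theorem wilfEquiv_gw_inv_ones {k : ℕ} (h5 : 5 ≤ k + 1) (he : Even k) :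
    WilfEquiv (pair1432 (circ (gw (k + 1) (B (List.replicate (k + 1) 1)))⁻¹))
      (pair1432 (circ (gw (k + 1) (B (List.replicate (k + 1) 1))))) := by
  have hl : ∀ j, ∀ x ∈ List.replicate j 1, 1 ≤ x :=
    fun j x hx => (List.eq_of_mem_replicate hx).ge
  apply wilfEquiv_of_ncard_containers
  intro n
  rw [ncard_containers_gw_inv n (by rw [length_B]; simp)
    (alternating_sublist_B (hl _) (by simpa using h5)), ncard_containers_gw_alternating n h5]
  congr 1
  ext u
  simp only [Set.mem_ofPred_eq]
  refine and_congr_right fun h1 => and_congr_right fun h2 => ?_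
  rw [← containsUpToNot_ones_iff k h2]
  have hek : Even (List.replicate k 1).length := by simpa using he
  have e1 : B (List.replicate (k + 1) 1) = B (List.replicate k 1) ++ [false] := by
    rw [List.replicate_succ', B_append_of_even hek]
    rfl
  have e2 : (B (List.replicate (k + 1) 1)).map (!·) = true :: B (List.replicate k 1) := by
    rw [B, map_not_wordFrom, List.replicate_succ, wordFrom_cons_of_pos le_rfl]
    rfl
  rw [ContainsUpToNot, e2, List.replicate_succ', contains_gw_inv_B_iff h1 (hl _)
    (by simp; omega) hek (by simp), ← List.replicate_succ', e1]
  constructor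
  · rintro ⟨i, j, hij, h3⟩
    rcases (show (i = 0 ∧ j = 1) ∨ (i = 1 ∧ j = 0) by omega) with ⟨rfl, rfl⟩ | ⟨rfl, rfl⟩
    · exact Or.inl (by simpa using h3)
    · exact Or.inr (by simpa using h3)
  · rintro (h3 | h3)
    · exact ⟨0, 1, rfl, by simpa using h3⟩
    · exact ⟨1, 0, rfl, by simpa using h3⟩

/-- Reverse complement sends 1^i B(l) 0^j to 1^j B(l reversed) 0^i, so the family with i + j = m is
preserved up to reversing `l`. It sends a last letter 1 to a first letter 0, and the shift 1x ↔ x0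
makes the counts under these two conditions agree. -/
theorem wilfEquiv_gw_inv_reverse {k m : ℕ} {l : List ℕ} (hl : ∀ x ∈ l, 1 ≤ x)
    (h4 : 4 ≤ l.length) (he : Even l.length) (hm : 1 ≤ m) (hs : l.sum + m = k + 1) :
    WilfEquiv (pair1432 (circ (gw (k + 1) (B (l ++ [m])))⁻¹))
      (pair1432 (circ (gw (k + 1) (B (l.reverse ++ [m])))⁻¹)) := by
  have pos : ∀ l : List ℕ, (∀ x ∈ l, 1 ≤ x) → ∀ x ∈ l ++ [m], 1 ≤ x := by
    intro l hl x hx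
    rcases List.mem_append.1 hx with hx | hx
    · exact hl x hx
    · rw [List.mem_singleton.1 hx]
      exact hm
  have hlr : ∀ x ∈ l.reverse, 1 ≤ x := fun x hx => hl x (by simpa using hx)
  apply wilfEquiv_of_ncard_containers
  intro n
  rw [ncard_containers_gw_inv n (by simp [length_B, hs])
      (alternating_sublist_B (pos l hl) (by simp; omega)),
    ncard_containers_gw_inv n (by simp [length_B, hs])
      (alternating_sublist_B (pos _ hlr) (by simp; omega)),
    ncard_head_eq_ncard_getLast (fun u => Contains (circ (gw (n + 1) u)⁻¹)
      (circ (gw (k + 1) (B (l ++ [m])))⁻¹))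
      (fun x hx => by rw [circ_gw_inv_shift hx])]
  rw [← Set.ncard_image_of_injective _ (List.reverse_injective.comp map_not_injective)]
  congr 1
  have key : ∀ (l : List ℕ) (u : List Bool), Even l.length →
      (∃ i j, i + j = m ∧ (List.replicate i true ++ (B l ++ List.replicate j false)).Sublist u) →
      ∃ i j, i + j = m ∧ (List.replicate i true ++ (B l.reverse ++
        List.replicate j false)).Sublist (u.map (!·)).reverse := by
    rintro l u he ⟨i, j, hij, h⟩
    refine ⟨j, i, by omega, ?_⟩
    have := (h.map (!·)).reverse
    rw [← reverse_map_not_B he]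
    simpa using this
  ext u
  simp only [Set.mem_image, Set.mem_ofPred_eq, Function.comp]
  constructor
  · rintro ⟨v, ⟨h1, h2, h3⟩, rfl⟩
    refine ⟨by simpa using h1, ?_, ?_⟩
    · rw [List.head?_reverse, List.getLast?_map, h2]
      rfl
    · rw [contains_gw_inv_B_iff (by simpa using h1) hlr (by simpa using h4) (by simpa using he)
        (by simpa using hs)]
      rw [contains_gw_inv_B_iff h1 hl h4 he hs] at h3
      exact key l v he h3
  · rintro ⟨h1, h2, h3⟩
    have e : ((u.map (!·)).reverse.map (!·)).reverse = u := by
      rw [List.map_reverse, List.reverse_reverse, map_not_map_not]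
    refine ⟨(u.map (!·)).reverse, ⟨by simpa using h1, ?_, ?_⟩, e⟩
    · rw [List.getLast?_reverse, List.head?_map, h2]
      rfl
    · rw [contains_gw_inv_B_iff h1 hlr (by simpa using h4) (by simpa using he)
        (by simpa using hs)] at h3
      rw [contains_gw_inv_B_iff (by simpa using h1) hl h4 he hs]
      have := key l.reverse u (by simpa using he) h3
      rwa [List.reverse_reverse] at this

/-! ### Reduction to the listed forms -/

theorem gw_two_runs {n : ℕ} (a b : ℕ) (hn : a + b = n) :
    gw n (List.replicate a false ++ List.replicate b true) = 1 := by
  have h := gw_four_runs (n := n) a b 0 0 (by omega)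
  simp only [List.replicate_zero, List.append_nil] at h
  rw [h]
  ext i
  change blockSwapFun b 0 0 i = i
  have := blockSwapFun_spec b 0 0 i
  omega

theorem isListed_gw {k : ℕ} {w : List Bool} (hw : w.length = k)
    (h : Form1 w ∨ Form2 w ∨ Form3 w) : IsListed ⟨k, circ (gw k w)⟩ := by
  subst hw
  exact Or.inl ⟨w, h, by rw [gw_length]⟩

theorem isListed_gw_inv {k : ℕ} {w : List Bool} (hw : w.length = k) (h : Form4 w) :
    IsListed ⟨k, circ (gw k w)⁻¹⟩ := by
  subst hw
  exact Or.inr ⟨w, h, by rw [gw_length]; rfl⟩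

theorem WilfEquiv.refl (S : Set Pattern) : WilfEquiv S S := fun _ _ => rfl

theorem wilfEquiv_circRevComp {m : ℕ} (P : CircPerm m) :
    WilfEquiv (pair1432 P) (pair1432 (circRevComp P)) :=
  fun n _ => (ncard_av_circRevComp n P).symm

theorem exists_ones_append (l : List ℕ) :
    ∃ (s : ℕ) (l' : List ℕ), l = List.replicate s 1 ++ l' ∧ ∀ h : l' ≠ [], l'.head h ≠ 1 := by
  induction l with
  | nil => exact ⟨0, [], rfl, by simp⟩
  | cons a l ih =>
    by_cases h : a = 1
    · obtain ⟨s, l', rfl, h'⟩ := ih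
      exact ⟨s + 1, l', by rw [h, List.replicate_succ, List.cons_append], h'⟩
    · exact ⟨0, a :: l, rfl, fun _ => h⟩

theorem exists_ones_append_ones {l : List ℕ} (hl : ¬ ∀ x ∈ l, x = 1) :
    ∃ (s r : ℕ) (l' : List ℕ) (h : l' ≠ []), l = List.replicate s 1 ++ l' ++ List.replicate r 1 ∧
      l'.head h ≠ 1 ∧ l'.getLast h ≠ 1 := by
  obtain ⟨s, l₁, rfl, h1⟩ := exists_ones_append l
  obtain ⟨r, l₂, h2, h3⟩ := exists_ones_append l₁.reverse
  have h4 : l₁ = l₂.reverse ++ List.replicate r 1 := by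
    rw [← List.reverse_reverse l₁, h2, List.reverse_append, List.reverse_replicate]
  have h0 : l₂ ≠ [] := by
    rintro rfl
    rw [h4] at hl
    refine hl fun x hx => ?_
    simp only [List.reverse_nil, List.nil_append, List.mem_append] at hx
    exact hx.elim List.eq_of_mem_replicate List.eq_of_mem_replicate
  have h0' : l₂.reverse ≠ [] := by simpa using h0
  refine ⟨s, r, l₂.reverse, h0', by rw [h4, List.append_assoc], ?_, ?_⟩
  · subst h4
    have := h1 (by simp [h0])
    rwa [List.head_append_of_ne_nil h0'] at this
  · rw [List.getLast_reverse]
    exact h3 h0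

theorem form2_ones {k : ℕ} (hk : 4 ≤ k + 1) : Form2 (B (List.replicate (k + 1) 1)) := by
  have hl : ∀ x ∈ List.replicate (k + 1) 1, 1 ≤ x := fun x hx => (List.eq_of_mem_replicate hx).ge
  refine ⟨head?_B (by simp) hl, (alternating_wordFrom_iff hl).2 fun x hx =>
    List.eq_of_mem_replicate hx, ?_⟩
  rw [B, numRuns_wordFrom hl]
  simpa using hk

theorem exists_listed_wilfEquiv_gw {k : ℕ} {l : List ℕ} (hl : ∀ x ∈ l, 1 ≤ x) (h3 : 3 ≤ l.length)
    (hs : l.sum = k + 1) : ∃ τ : Equiv.Perm (Fin (k + 1)), IsListed ⟨k + 1, circ τ⟩ ∧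
      WilfEquiv (pair1432 (circ (gw (k + 1) (B l)))) (pair1432 (circ τ)) := by
  by_cases h4 : 4 ≤ l.length
  · by_cases hones : ∀ x ∈ l, x = 1
    · have hl1 : l = List.replicate (k + 1) 1 := by
        have := List.eq_replicate_of_mem hones
        rw [this] at hs
        simp only [List.sum_replicate, smul_eq_mul, mul_one] at hs
        rw [this, hs]
      refine ⟨gw (k + 1) (B l), isListed_gw (by rw [length_B, hs]) (Or.inr (Or.inl ?_)),
        WilfEquiv.refl _⟩
      rw [hl1] at h4 ⊢
      exact form2_ones (by simpa using h4)
    · obtain ⟨s, r, l', h0, rfl, hh, hlast⟩ := exists_ones_append_ones hones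
      have hl' : ∀ x ∈ l', 1 ≤ x := fun x hx => hl x (by simp [hx])
      obtain ⟨e1, e2⟩ := count_B_ones s r h0 hl'
      have finish : ∀ (m : List ℕ) (h0 : m ≠ []), (∀ x ∈ m, 1 ≤ x) → m.length = l'.length →
          m.sum = l'.sum → m.head h0 ≠ 1 → m.getLast h0 ≠ 1 → m.reverse ≤ m →
          count (B (List.replicate s 1 ++ l' ++ List.replicate r 1)) =
            count (B (m ++ List.replicate (s + r) 1)) →
          ∃ τ : Equiv.Perm (Fin (k + 1)), IsListed ⟨k + 1, circ τ⟩ ∧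
            WilfEquiv (pair1432 (circ (gw (k + 1)
              (B (List.replicate s 1 ++ l' ++ List.replicate r 1))))) (pair1432 (circ τ)) := by
        intro m h0 hm hlen hsum hh hlast hle he
        have hp : ∀ x ∈ m ++ List.replicate (s + r) 1, 1 ≤ x := by
          intro x hx
          rcases List.mem_append.1 hx with hx | hx
          · exact hm x hx
          · exact (List.eq_of_mem_replicate hx).ge
        have hlen' : (List.replicate s 1 ++ l' ++ List.replicate r 1).length =
            (m ++ List.replicate (s + r) 1).length := by
          simp only [List.length_append, List.length_replicate, hlen]
          omega
        have hs' : (m ++ List.replicate (s + r) 1).sum = k + 1 := by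
          rw [← hs]
          simp only [List.sum_append, List.sum_replicate, smul_eq_mul, mul_one, hsum]
          omega
        refine ⟨gw (k + 1) (B (m ++ List.replicate (s + r) 1)),
          isListed_gw (by rw [length_B, hs']) (Or.inr (Or.inr ⟨m, h0, s + r, hm, rfl, ?_, hh, hlast,
            hle⟩)), wilfEquiv_gw hl hp h4 hlen' hs hs' he⟩
        rw [B, numRuns_wordFrom hp, ← hlen']
        exact h4
      -- `l'` and its reverse have the same counts, so the lexicographically larger one is chosen.
      rcases le_total l'.reverse l' with hle | hle
      · exact finish l' h0 hl' rfl rfl hh hlast hle e1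
      · refine finish l'.reverse (by simpa using h0) (fun x hx => hl' x (by simpa using hx))
          (by simp) (by simp) ?_ ?_ (by rwa [List.reverse_reverse]) e2
        · rwa [List.head_reverse]
        · rwa [List.getLast_reverse]
  · match l, h3, h4 with
    | [a, b, c], _, _ =>
      have ha : 1 ≤ a := hl a (by simp)
      have hb : 1 ≤ b := hl b (by simp)
      have hc : 1 ≤ c := hl c (by simp)
      by_cases hca : c ≤ a
      · exact ⟨gw (k + 1) (B [a, b, c]), isListed_gw (by rw [length_B, hs])
          (Or.inl ⟨a, b, c, ha, hb, hc, hca, rfl⟩), WilfEquiv.refl _⟩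
      · have hw : (B [a, b, c]).length = k + 1 := by rw [length_B, hs]
        -- For three runs, reverse complement followed by complementing the word exchanges the two
        -- outer runs.
        have e : circRevComp (circ (gw (k + 1) (B [a, b, c]))) =
            circ (gw (k + 1) (B [c, b, a])) := by
          rw [circRevComp_circ, revComp_gw hw, circ_gw_map_not (by simpa using hw), B,
            reverse_wordFrom]
          rfl
        refine ⟨gw (k + 1) (B [c, b, a]), isListed_gw ?_
          (Or.inl ⟨c, b, a, hc, hb, ha, (not_le.1 hca).le, rfl⟩), ?_⟩
        · rw [length_B, ← hs]
          simp
          omega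
        · rw [← e]
          exact wilfEquiv_circRevComp _
    | _ :: _ :: _ :: _ :: _, _, h4 => simp at h4

theorem exists_listed_wilfEquiv_gw_inv {k : ℕ} {l : List ℕ} (hl : ∀ x ∈ l, 1 ≤ x)
    (h3 : 3 ≤ l.length) (hs : l.sum = k + 1) :
    ∃ τ : Equiv.Perm (Fin (k + 1)), IsListed ⟨k + 1, circ τ⟩ ∧
      WilfEquiv (pair1432 (circ (gw (k + 1) (B l))⁻¹)) (pair1432 (circ τ)) := by
  have hlen : ∀ {m : List ℕ}, (∀ x ∈ m, 1 ≤ x) → m.sum = k + 1 → m.length ≤ k + 1 := by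
    intro m hm hms
    have := (wordFrom_ones_sublist (b := false) hm le_rfl).length_le
    rw [length_wordFrom, length_wordFrom, hms] at this
    simpa using this
  by_cases h5 : 5 ≤ l.length
  · have hk := hlen hl hs
    have listed : IsListed ⟨k + 1, circ (gw (k + 1) (B (List.replicate (k + 1) 1)))⟩ :=
      isListed_gw (by simp [length_B]) (Or.inr (Or.inl (form2_ones (by omega))))
    by_cases he : Even l.length
    · exact ⟨_, listed, wilfEquiv_gw_inv_even hl h5 he hs⟩
    · by_cases hones : ∀ x ∈ l, x = 1
      · have hl1 := List.eq_replicate_of_mem hones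
        have hlk : l.length = k + 1 := by
          rw [hl1] at hs
          simpa using hs
        rw [hlk] at hl1 he
        rw [hl1]
        refine ⟨_, listed, wilfEquiv_gw_inv_ones (by omega) ?_⟩
        rw [Nat.even_add_one, not_not] at he
        exact he
      · obtain ⟨l', m, rfl⟩ : ∃ l' m, l = l' ++ [m] := by
          rcases List.eq_nil_or_concat l with rfl | ⟨l', m, h⟩
          · simp at h3
          · exact ⟨l', m, by rw [h, List.concat_eq_append]⟩
        have hl' : ∀ x ∈ l', 1 ≤ x := fun x hx => hl x (by simp [hx])
        have hm : 1 ≤ m := hl m (by simp)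
        simp only [List.length_append, List.length_singleton, Nat.even_add_one, not_not] at he h5
        simp only [List.sum_append, List.sum_singleton] at hs
        have finish : ∀ p : List ℕ, (∀ x, x ∈ p ↔ x ∈ l') → p.length = l'.length →
            p.sum = l'.sum → p.reverse ≤ p →
            IsListed ⟨k + 1, circ (gw (k + 1) (B (p ++ [m])))⁻¹⟩ := by
          intro p hp hpl hps hle
          have hpos : ∀ x ∈ p ++ [m], 1 ≤ x := by
            intro x hx
            rw [List.mem_append, hp, ← List.mem_append] at hx
            exact hl x hx
          refine isListed_gw_inv (by simp [length_B, hps, hs]) ⟨p, m, fun x hx => hl' x ((hp x).1 hx),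
            by rwa [hpl], hm, rfl, ?_, ?_, hle⟩
          · rw [B, alternating_wordFrom_iff hpos]
            simpa only [List.mem_append, hp] using hones
          · rw [B, numRuns_wordFrom hpos]
            simp [hpl]
            omega
        rcases le_total l'.reverse l' with hle | hle
        · exact ⟨_, finish l' (fun _ => Iff.rfl) rfl rfl hle, WilfEquiv.refl _⟩
        · exact ⟨_, finish l'.reverse (by simp) (by simp) (by simp)
            (by rwa [List.reverse_reverse]),
            wilfEquiv_gw_inv_reverse hl' (by omega) he hm hs⟩
  -- With three or four runs the inverse belongs to the G family again, with the second and third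
  -- run sizes exchanged; three runs are the case `d = 0`.
  · have reduce : ∀ a b c d : ℕ, a + b + c + d = k + 1 →
        (gw (k + 1) (List.replicate a false ++ (List.replicate b true ++ (List.replicate c false ++
          List.replicate d true))))⁻¹ = _ := fun a b c d h => gw_inv_four_runs a b c d h
    match l, h3, h5 with
    | [a, b, c], _, _ =>
      have hs' : a + b + c + 0 = k + 1 := by simp at hs; omega
      rw [B_three, reduce a b c 0 hs', ← B_three]
      refine exists_listed_wilfEquiv_gw (fun x hx => hl x ?_) (by simp) (by simp; omega)
      simp only [List.mem_cons, List.not_mem_nil, or_false] at hx ⊢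
      tauto
    | [a, b, c, d], _, _ =>
      have hs' : a + b + c + d = k + 1 := by simp at hs; omega
      rw [B_four, reduce a b c d hs', ← B_four]
      refine exists_listed_wilfEquiv_gw (fun x hx => hl x ?_) (by simp) (by simp; omega)
      simp only [List.mem_cons, List.not_mem_nil, or_false] at hx ⊢
      tauto
    | _ :: _ :: _ :: _ :: _ :: _, _, h5 => simp at h5

theorem three_le_length_of_gw_ne_one {n : ℕ} {l : List ℕ} (hs : l.sum = n) (h : gw n (B l) ≠ 1) :
    3 ≤ l.length := by
  by_contra hc
  apply h
  match l, hc with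
  | [], _ =>
    simp only [List.sum_nil] at hs
    subst hs
    exact Subsingleton.elim _ _
  | [a], _ => simpa [B, wordFrom] using gw_two_runs (n := n) a 0 (by simpa using hs)
  | [a, b], _ => simpa [B, wordFrom] using gw_two_runs (n := n) a b (by simpa using hs)
  | _ :: _ :: _ :: _, hc => simp at hc

end CircularPatterns

theorem mainTheorem8 (k : ℕ) (σ : Equiv.Perm (Fin k))
    (hav : ¬ CircularPatterns.Contains (CircularPatterns.circ σ)
      (CircularPatterns.circ CircularPatterns.perm1432))
    (hid : CircularPatterns.circ σ ≠ CircularPatterns.circ (1 : Equiv.Perm (Fin k))) :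
    ∃ τ : Equiv.Perm (Fin k),
      CircularPatterns.IsListed ⟨k, CircularPatterns.circ τ⟩ ∧
      CircularPatterns.WilfEquiv
        (CircularPatterns.pair1432 (CircularPatterns.circ σ))
        (CircularPatterns.pair1432 (CircularPatterns.circ τ)) := by
  open CircularPatterns in
  rcases k with _ | k
  · exact absurd (congrArg circ (Subsingleton.elim σ 1)) hid
  obtain ⟨x, hx, h⟩ := exists_word_of_not_contains_perm1432 σ hav
  obtain ⟨l, -, hl, hxl⟩ := exists_eq_B x
  have hs : l.sum = k + 1 := by rw [← length_B, ← hxl, List.length_cons, hx]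
  rw [hxl] at h
  -- At most two runs would give the identity, for G and IG alike.
  have h3 : 3 ≤ l.length := by
    refine three_le_length_of_gw_ne_one hs fun h1 => hid ?_
    rw [h1, inv_one, or_self] at h
    exact h
  rcases h with h | h
  · rw [h]
    exact exists_listed_wilfEquiv_gw hl h3 hs
  · rw [h]
    exact exists_listed_wilfEquiv_gw_inv hl h3 hs
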